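/- All graphs are finite and simple. For a cooperative game $(N,v)$ an allocation is a vector $x\in\mathbb R^N$ with $x(N)=v(N)$, and the core is the set of all allocations $x$ with $x(S)\ge v(S)$ for every $S\subseteq N$, where $x(S)=\sum_{p\in S}x_p$. Let $G=(V,E)$ be a graph with positive edge weights $w$. The *$b$-matching game* on $(G,b,w)$, where $b:V\to\{1,2,\dots\}$, has player set $V$, and $v(S)$ is the maximum weight of a set of edges of $G[S]$ such that each vertex $p$ lies on at most $b(p)$ of them; put $b^*=\max_{p\in V} b(p)$. The *partitioned matching game* on $(G,w,(V_1,\dots,V_n))$, where $(V_1,\dots,V_n)$ is a partition of $V$ into non-empty sets, has player set $\{1,\dots,n\}$, and $v(S)$ is the maximum weight of a matching of $G[\bigcup_{p\in S}V_p]$; its width is $c=\max_p |V_p|$. (A maximum over the empty set is $0$.) Instances are graphs given by edge lists with positive rational weights, together with $b$ or with the partition; all numbers are written in binary, and rational numbers as fractions. Consider the following problems for a class of games: * **P1**: for a given (rational) allocation $x$, determine whether $x$ is in the core, or else find a coalition $S$ with $x(S)<v(S)$; * **P2**: determine whether the core is non-empty; * **P3**: find a (rational) allocation in the core, if there is one.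 **Theorem.** Each of P1, P2, P3 can be reduced in polynomial time from partitioned matching games to $b$-matching games, in such a way that an instance of width $c$ is mapped to an instance whose capacity function satisfies $b^*\le c$. More precisely: * P1: there is a polynomial-time map that sends a partitioned matching game with an allocation $x$ to a $b$-matching game with an allocation $\overline x$ such that $x$ is in the core if and only if $\overline x$ is in the core, and a polynomial-time algorithm that turns any coalition $\overline S$ with $\overline x(\overline S)<\overline v(\overline S)$ into a coalition $S$ with $x(S)<v(S)$; * P2: there is a polynomial-time map from partitioned matching games to $b$-matching games such that the core of a game is non-empty if and only if the core of its image is non-empty; * P3: there is a polynomial-time map from partitioned matching games to $b$-matching games such that a game has a rational core allocation if and only if its image has one, and a polynomial-time algorithm that turns any rational core allocation of the image into a rational core allocation of the original game. -/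

import Mathlib

noncomputable section

/-! ### Cooperative games -/

/-- A cooperative game with player set `N`. -/
structure CoopGame (N : Type*) where
  v : Finset N → ℝ
  v_empty : v ∅ = 0

namespace CoopGame

variable {N : Type*} [Fintype N]

/-- An allocation distributes the value of the grand coalition among the players. -/
def IsAllocation (Γ : CoopGame N) (x : N → ℝ) : Prop :=
  ∑ p, x p = Γ.v Finset.univ

/-- The core: all allocations `x` with `x(S) ≥ v(S)` for every coalition `S`. -/
def core (Γ : CoopGame N) : Set (N → ℝ) :=
  {x | Γ.IsAllocation x ∧ ∀ S : Finset N, Γ.v S ≤ ∑ p ∈ S, x p}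

end CoopGame

/-! ### Matchings, `b`-matchings and their games -/

section Matching

variable {V : Type*}

/-- `M` is a set of edges of the subgraph of `G` induced by `S`. -/
def EdgesWithin (G : SimpleGraph V) (S : Finset V) (M : Finset (Sym2 V)) : Prop :=
  ∀ e ∈ M, e ∈ G.edgeSet ∧ ∀ p ∈ e, p ∈ S

theorem edgesWithin_empty {G : SimpleGraph V} {M : Finset (Sym2 V)}
    (h : EdgesWithin G ∅ M) : M = ∅ := by
  refine Finset.eq_empty_of_forall_notMem fun e he => ?_
  induction e with
  | _ a b => simpa using (h _ he).2 a (by simp)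

/-- No two different edges of `M` have a common end-vertex. -/
def NoCommonEnd (M : Finset (Sym2 V)) : Prop :=
  ∀ e ∈ M, ∀ f ∈ M, e ≠ f → ∀ p ∈ e, p ∉ f

open Classical in
/-- Every vertex `p` is incident to at most `b p` edges of `M`. -/
def RespectsCapacity (b : V → ℕ+) (M : Finset (Sym2 V)) : Prop :=
  ∀ p, (M.filter (fun e => p ∈ e)).card ≤ (b p : ℕ)

variable [Fintype V]

open Classical in
/-- The matchings of the induced subgraph `G[S]`. -/
def matchingsOn (G : SimpleGraph V) (S : Finset V) : Finset (Finset (Sym2 V)) :=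
  Finset.univ.filter fun M => EdgesWithin G S M ∧ NoCommonEnd M

open Classical in
/-- The `b`-matchings of the induced subgraph `G[S]`. -/
def bMatchingsOn (G : SimpleGraph V) (b : V → ℕ+) (S : Finset V) : Finset (Finset (Sym2 V)) :=
  Finset.univ.filter fun M => EdgesWithin G S M ∧ RespectsCapacity b M

theorem empty_mem_matchingsOn (G : SimpleGraph V) (S : Finset V) :
    ∅ ∈ matchingsOn G S := by
  classical
  exact Finset.mem_filter.2 ⟨Finset.mem_univ _, by simp [EdgesWithin, NoCommonEnd]⟩

theorem empty_mem_bMatchingsOn (G : SimpleGraph V) (b : V → ℕ+) (S : Finset V) :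
    ∅ ∈ bMatchingsOn G b S := by
  classical
  exact Finset.mem_filter.2 ⟨Finset.mem_univ _, by simp [EdgesWithin, RespectsCapacity]⟩

/-- The maximum weight of a matching of `G[S]`. -/
def maxMatching (G : SimpleGraph V) (w : Sym2 V → ℝ) (S : Finset V) : ℝ :=
  (matchingsOn G S).sup' ⟨∅, empty_mem_matchingsOn G S⟩ fun M => ∑ e ∈ M, w e

/-- The maximum weight of a `b`-matching of `G[S]`. -/
def maxBMatching (G : SimpleGraph V) (b : V → ℕ+) (w : Sym2 V → ℝ) (S : Finset V) : ℝ :=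
  (bMatchingsOn G b S).sup' ⟨∅, empty_mem_bMatchingsOn G b S⟩ fun M => ∑ e ∈ M, w e

/-- The `b`-matching game on `(G, b, w)`: the players are the vertices. -/
def bMatchingGame (G : SimpleGraph V) (b : V → ℕ+) (w : Sym2 V → ℝ) : CoopGame V where
  v := maxBMatching G b w
  v_empty := by
    refine le_antisymm (Finset.sup'_le _ _ fun M hM => ?_)
      (Finset.le_sup'_of_le _ (empty_mem_bMatchingsOn G b ∅) (by simp))
    have h : EdgesWithin G ∅ M := by
      classical
      exact (Finset.mem_filter.1 hM).2.1
    rw [edgesWithin_empty h, Finset.sum_empty]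

open Classical in
/-- The partitioned matching game on `(G, w, 𝒱)`, where the parts of the partition `𝒱` are the
fibres `V_p = {u | part u = p}` of a map `part` onto the set `N` of players. -/
def partitionedMatchingGame {N : Type*} (G : SimpleGraph V) (w : Sym2 V → ℝ) (part : V → N) :
    CoopGame N where
  v S := maxMatching G w (Finset.univ.filter fun u => part u ∈ S)
  v_empty := by
    refine le_antisymm (Finset.sup'_le _ _ fun M hM => ?_)
      (Finset.le_sup'_of_le _ (empty_mem_matchingsOn G _) (by simp))
    have h := (Finset.mem_filter.1 hM).2.1
    simp only [Finset.notMem_empty, Finset.filter_false] at h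
    rw [edgesWithin_empty h, Finset.sum_empty]

open Classical in
/-- The width of a partition: the maximum size of a part. -/
def partitionWidth {N : Type*} [Fintype N] (part : V → N) : ℕ :=
  Finset.univ.sup fun p => (Finset.univ.filter fun u => part u = p).card

/-- The number `b*`: the maximum capacity of a vertex. -/
def maxCapacity (b : V → ℕ+) : ℕ :=
  Finset.univ.sup fun p => (b p : ℕ)

end Matching

/-! ### The model of computation

A while-language over S-expressions whose atoms are integers, under the logarithmic cost criterion:
executing an elementary operation costs the number of bits that are read and written. -/

/-- S-expressions with integer atoms. -/
inductive Data where
  | int (z : ℤ)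
  | pair (d e : Data)

/-- The size of an S-expression: the lengths of the atoms in binary, plus one for each sign and
each node. -/
def Data.size : Data → ℕ
  | .int z => z.natAbs.size + 1
  | .pair d e => d.size + e.size + 1

/-- The elementary operations. -/
inductive Op where
  | id
  | const (d : Data)
  | fst
  | snd
  | isInt
  | add
  | sub
  | mul
  | le

/-- The result of an elementary operation; `0` where its operand has the wrong form. -/
def Op.run : Op → Data → Data
  | .id, d => d
  | .const c, _ => c
  | .fst, .pair d _ => d
  | .snd, .pair _ e => e
  | .isInt, .int _ => .int 1
  | .add, .pair (.int a) (.int b) => .int (a + b)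
  | .sub, .pair (.int a) (.int b) => .int (a - b)
  | .mul, .pair (.int a) (.int b) => .int (a * b)
  | .le, .pair (.int a) (.int b) => .int (if a ≤ b then 1 else 0)
  | _, _ => .int 0

/-- Programs. `seq p q` runs `p` and then `q` on the result; `pair p q` runs both on the same input
and pairs their results; `ite` and `loop` branch on whether a test returns the atom `0`. -/
inductive Prog where
  | op (o : Op)
  | seq (p q : Prog)
  | pair (p q : Prog)
  | ite (c p q : Prog)
  | loop (c p : Prog)

/-- `Prog.Runs p d r t`: on input `d` the program `p` halts with the result `r` after a computation
of cost `t`. -/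
inductive Prog.Runs : Prog → Data → Data → ℕ → Prop where
  | op (o : Op) (d : Data) : Runs (.op o) d (o.run d) (d.size + (o.run d).size)
  | seq {p q : Prog} {d e r : Data} {s t : ℕ} :
      Runs p d e s → Runs q e r t → Runs (.seq p q) d r (s + t + 1)
  | pair {p q : Prog} {d e r : Data} {s t : ℕ} :
      Runs p d e s → Runs q d r t → Runs (.pair p q) d (.pair e r) (s + t + 1)
  | ite_true {c p q : Prog} {d e r : Data} {s t : ℕ} :
      Runs c d e s → e ≠ .int 0 → Runs p d r t → Runs (.ite c p q) d r (s + t + 1)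
  | ite_false {c p q : Prog} {d r : Data} {s t : ℕ} :
      Runs c d (.int 0) s → Runs q d r t → Runs (.ite c p q) d r (s + t + 1)
  | loop_done {c p : Prog} {d : Data} {s : ℕ} :
      Runs c d (.int 0) s → Runs (.loop c p) d d (s + 1)
  | loop_step {c p : Prog} {d e d' r : Data} {s t u : ℕ} :
      Runs c d e s → e ≠ .int 0 → Runs p d d' t → Runs (.loop c p) d' r u →
      Runs (.loop c p) d r (s + t + u + 1)

/-- Types whose elements are written down as S-expressions. -/
class Coded (α : Type) where
  code : α → Data

instance : Coded ℤ := ⟨Data.int⟩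
instance : Coded ℕ := ⟨fun n => .int n⟩
instance : Coded ℕ+ := ⟨fun n => .int n⟩
instance (n : ℕ) : Coded (Fin n) := ⟨fun i => .int (i : ℕ)⟩
instance {α β : Type} [Coded α] [Coded β] : Coded (α × β) :=
  ⟨fun a => .pair (Coded.code a.1) (Coded.code a.2)⟩
instance {α : Type} [Coded α] : Coded (List α) :=
  ⟨fun l => l.foldr (fun a d => .pair (Coded.code a) d) (.int 0)⟩

/-- `f` is computed by a program whose cost is at most a polynomial in the size of the input. -/
def PolyTime {α β : Type} [Coded α] [Coded β] (f : α → β) : Prop :=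
  ∃ (p : Prog) (P : Polynomial ℕ), ∀ a : α, ∃ t : ℕ,
    p.Runs (Coded.code a) (Coded.code (f a)) t ∧ t ≤ P.eval (Coded.code a).size

/-- Polynomial-time many-one reduction between decision problems `A` and `B` that does not increase
the parameter (`κA` on instances of `A`, `κB` on instances of `B`). -/
def DecisionReduces {α β : Type} [Coded α] [Coded β]
    (A : α → Prop) (κA : α → ℕ) (B : β → Prop) (κB : β → ℕ) : Prop :=
  ∃ f : α → β, PolyTime f ∧ ∀ a, κB (f a) ≤ κA a ∧ (A a ↔ B (f a))

/-- Polynomial-time many-one (Levin) reduction between search problems that does not increase the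
parameter. `A a s` means that `s` is a solution of the instance `a`. An instance has a solution if
and only if its image has one, and solutions of the image are translated back in polynomial time. -/
def SearchReduces {α σ β τ : Type} [Coded α] [Coded σ] [Coded β] [Coded τ]
    (A : α → σ → Prop) (κA : α → ℕ) (B : β → τ → Prop) (κB : β → ℕ) : Prop :=
  ∃ (f : α → β) (g : α × τ → σ), PolyTime f ∧ PolyTime g ∧
    ∀ a, κB (f a) ≤ κA a ∧ ((∃ s, A a s) ↔ ∃ t, B (f a) t) ∧
      ∀ t, B (f a) t → A a (g (a, t))

/-! ### Instances

Rational numbers are given as fractions (not necessarily in lowest terms). -/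

/-- The value of a fraction. -/
def fracVal (q : ℤ × ℕ+) : ℝ := (q.1 : ℝ) / ((q.2 : ℕ) : ℝ)

/-- The value of a positive fraction. -/
def posFracVal (q : ℕ+ × ℕ+) : ℝ := ((q.1 : ℕ) : ℝ) / ((q.2 : ℕ) : ℝ)

/-- A finite graph with vertices `0, …, n - 1` and positive rational edge weights, given by the list
of its edges `uv`, each listed once with its weight. -/
structure WGraph (n : ℕ) where
  edges : List ((Fin n × Fin n) × (ℕ+ × ℕ+))
  ne : ∀ e ∈ edges, e.1.1 ≠ e.1.2
  nodup : (edges.map fun e => s(e.1.1, e.1.2)).Nodup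

namespace WGraph

variable {n : ℕ}

/-- The underlying graph. -/
def graph (H : WGraph n) : SimpleGraph (Fin n) :=
  SimpleGraph.fromEdgeSet {e | e ∈ H.edges.map fun e => s(e.1.1, e.1.2)}

/-- The edge weighting; the sum below has exactly one term when `e` is an edge. -/
def weight (H : WGraph n) (e : Sym2 (Fin n)) : ℝ :=
  ((H.edges.filter fun f => s(f.1.1, f.1.2) = e).map fun f => posFracVal f.2).sum

end WGraph

instance (n : ℕ) : Coded (WGraph n) := ⟨fun H => Coded.code H.edges⟩

/-- A description of a partitioned matching game with players `0, …, k - 1`: a weighted graph, and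
for each vertex the (index of the) part that contains it; no part is empty. -/
structure PMInstance where
  n : ℕ
  k : ℕ
  graph : WGraph n
  part : Fin n → Fin k
  part_surj : Function.Surjective part

/-- A description of a `b`-matching game: a weighted graph and a capacity for each vertex. -/
structure BMInstance where
  n : ℕ
  graph : WGraph n
  cap : Fin n → ℕ+

instance : Coded PMInstance :=
  ⟨fun I => Coded.code (I.k, List.ofFn I.part, I.graph)⟩

instance : Coded BMInstance :=
  ⟨fun I => Coded.code (List.ofFn I.cap, I.graph)⟩

/-- The partitioned matching game that is described. -/
def PMInstance.game (I : PMInstance) : CoopGame (Fin I.k) :=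
  partitionedMatchingGame I.graph.graph I.graph.weight I.part

/-- The `b`-matching game that is described. -/
def BMInstance.game (I : BMInstance) : CoopGame (Fin I.n) :=
  bMatchingGame I.graph.graph I.cap I.graph.weight

/-- The width. -/
def PMInstance.width (I : PMInstance) : ℕ := partitionWidth I.part

/-- The maximum capacity `b*`. -/
def BMInstance.bstar (I : BMInstance) : ℕ := maxCapacity I.cap

/-- A partitioned matching game together with a (rational) allocation. -/
structure PMAllocInstance where
  inst : PMInstance
  x : Fin inst.k → ℤ × ℕ+
  isAllocation : inst.game.IsAllocation fun i => fracVal (x i)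

/-- A `b`-matching game together with a (rational) allocation. -/
structure BMAllocInstance where
  inst : BMInstance
  x : Fin inst.n → ℤ × ℕ+
  isAllocation : inst.game.IsAllocation fun i => fracVal (x i)

instance : Coded PMAllocInstance := ⟨fun J => Coded.code (J.inst, List.ofFn J.x)⟩

instance : Coded BMAllocInstance := ⟨fun J => Coded.code (J.inst, List.ofFn J.x)⟩

/-! ### The core problems -/

/-- The list `L` of players describes a coalition `S` with `x(S) < v(S)`. -/
def IsViolated {m : ℕ} (Γ : CoopGame (Fin m)) (x : Fin m → ℝ) (L : List ℕ) : Prop :=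
  (∀ a ∈ L, a < m) ∧
    ∑ p ∈ Finset.univ.filter (fun p : Fin m => (p : ℕ) ∈ L), x p <
      Γ.v (Finset.univ.filter fun p : Fin m => (p : ℕ) ∈ L)

/-- The list `L` of fractions describes an allocation in the core. -/
def IsCoreList {m : ℕ} (Γ : CoopGame (Fin m)) (L : List (ℤ × ℕ+)) : Prop :=
  ∃ x : Fin m → ℤ × ℕ+, L = List.ofFn x ∧ (fun i => fracVal (x i)) ∈ Γ.core

/-- Problem P1 for partitioned matching games: for a given allocation `x`, find a coalition `S` with
`x(S) < v(S)`, or determine that there is none, that is, that `x` belongs to the core. -/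
def PM.P1 (J : PMAllocInstance) (L : List ℕ) : Prop :=
  IsViolated J.inst.game (fun i => fracVal (J.x i)) L

/-- Problem P1 for `b`-matching games. -/
def BM.P1 (J : BMAllocInstance) (L : List ℕ) : Prop :=
  IsViolated J.inst.game (fun i => fracVal (J.x i)) L

/-- Problem P2 for partitioned matching games: determine if the core is non-empty. -/
def PM.P2 (I : PMInstance) : Prop := I.game.core.Nonempty

/-- Problem P2 for `b`-matching games. -/
def BM.P2 (I : BMInstance) : Prop := I.game.core.Nonempty

/-- Problem P3 for partitioned matching games: find an allocation in the core (if there is one). -/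
def PM.P3 (I : PMInstance) (L : List (ℤ × ℕ+)) : Prop := IsCoreList I.game L

/-- Problem P3 for `b`-matching games. -/
def BM.P3 (I : BMInstance) (L : List (ℤ × ℕ+)) : Prop := IsCoreList I.game L

end

/-! Write `V_p` for the part of the player `p`, `w(G)` for the total edge weight, and let `K` be a
large integer. Suppose first that some part has at least two vertices. The `b`-matching game is
played on a copy of `G` together with one new vertex per player. Each vertex `u` is joined to its
player by a pendant edge of weight `2K`. Copies of vertices have capacity 2, and the player `p` has
capacity `|V_p|`. An allocation `x` becomes the one that pays `K` to each vertex and `K|V_p| + x_p`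
to each player, so that the weight of every pendant edge is shared equally by its two ends.

Call a coalition full if it consists of a set `T` of players and all their vertices. Since `2K ≥
w(G)`, some optimal `b`-matching of a full coalition uses all its pendant edges. These leave one
unit of capacity at each vertex, so the remaining edges form an ordinary matching. The pendant edges
contribute exactly what the terms with `K` pay, and the excess of the full coalition equals the
excess of `T` in the original game (`wide_value`, `wide_excess`).

Let `S` be any other coalition, `A` its set of vertices and `B` the set of vertices owned by its
players. Its value is at most `w(G) + 2K|A ∩ B|`, while its payment is at least `K(|A| + |B|) - ∑
|x_p|`. As `A ≠ B`, we have `|A| + |B| ≥ 2|A ∩ B| + 1`, and so `S` is not violated once `K ≥ w(G) +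
∑ |x_p|` (`wide_violated`). Hence only full coalitions matter. For P2 and P3 the bound on `K` must
not depend on `x`; core allocations are non-negative with sum `v(N) ≤ w(G)`, so `K ≥ 2w(G)`
suffices. Conversely, a core allocation of the image, summed over each player and its vertices and
reduced by `2K|V_p|`, is a core allocation of the original game.

If every part is a singleton, the width is 1 and capacity 2 is not allowed. Then there are no
pendant edges, all capacities are 1, and the new vertices are isolated null players (`thin_excess`).

For the running times, the translations are written as functions on lists of integers with the same
encodings as the instances, and are assembled from functions already known to be computable in
polynomial time. The main tool is a fold over a list in which the size of the state stays under
control. -/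

noncomputable section

/-! ### Polynomially bounded quantities -/

/-- The size of the encoding of `a`. -/
def codeSize {α : Type} [Coded α] (a : α) : ℕ := (Coded.code a).size

/-- `T` is bounded by a polynomial in the size of the argument. -/
def PolyBounded {α : Type} [Coded α] (T : α → ℕ) : Prop :=
  ∃ P : Polynomial ℕ, ∀ a, T a ≤ P.eval (codeSize a)

/-- Coefficients in `ℕ` are non-negative. This monotonicity lets cost bounds be composed. -/
theorem Polynomial.eval_mono_nat (P : Polynomial ℕ) {m n : ℕ} (h : m ≤ n) :
    P.eval m ≤ P.eval n := by
  simp only [Polynomial.eval_eq_sum_range]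
  gcongr

namespace PolyBounded

variable {α β : Type} [Coded α] [Coded β] {S T : α → ℕ}

theorem mono (hT : PolyBounded T) (h : ∀ a, S a ≤ T a) : PolyBounded S :=
  hT.imp fun _ hP a => (h a).trans (hP a)

theorem const (n : ℕ) : PolyBounded fun _ : α => n := ⟨Polynomial.C n, by simp⟩

theorem size : PolyBounded (codeSize : α → ℕ) := ⟨Polynomial.X, by simp⟩

theorem add (hS : PolyBounded S) (hT : PolyBounded T) : PolyBounded fun a => S a + T a := by
  obtain ⟨P, hP⟩ := hS
  obtain ⟨Q, hQ⟩ := hT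
  exact ⟨P + Q, fun a => by simpa using add_le_add (hP a) (hQ a)⟩

theorem mul (hS : PolyBounded S) (hT : PolyBounded T) : PolyBounded fun a => S a * T a := by
  obtain ⟨P, hP⟩ := hS
  obtain ⟨Q, hQ⟩ := hT
  exact ⟨P * Q, fun a => by simpa using Nat.mul_le_mul (hP a) (hQ a)⟩

theorem eval (P : Polynomial ℕ) (hT : PolyBounded T) : PolyBounded fun a => P.eval (T a) := by
  obtain ⟨Q, hQ⟩ := hT
  exact ⟨P.comp Q, fun a => by simpa using P.eval_mono_nat (hQ a)⟩

theorem comp {U : β → ℕ} (hU : PolyBounded U) {f : α → β}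
    (hf : PolyBounded fun a => codeSize (f a)) : PolyBounded fun a => U (f a) := by
  obtain ⟨P, hP⟩ := hU
  exact (hf.eval P).mono fun a => hP (f a)

end PolyBounded

/-! ### Sizes of encodings -/

section Sizes

variable {α β : Type} [Coded α] [Coded β]

theorem Data.one_le_size (d : Data) : 1 ≤ d.size := by
  cases d <;> simp [Data.size]

theorem code_int (z : ℤ) : Coded.code z = Data.int z := rfl

theorem code_pair (a : α) (b : β) : Coded.code (a, b) = .pair (Coded.code a) (Coded.code b) := rfl

theorem code_nil : Coded.code ([] : List α) = .int 0 := rfl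

theorem code_cons (a : α) (l : List α) :
    Coded.code (a :: l) = .pair (Coded.code a) (Coded.code l) := rfl

theorem codeSize_int (z : ℤ) : codeSize z = z.natAbs.size + 1 := rfl

theorem codeSize_pair (a : α) (b : β) : codeSize (a, b) = codeSize a + codeSize b + 1 := rfl

theorem codeSize_nil : codeSize ([] : List α) = 1 := by
  simp [codeSize, code_nil, Data.size]

theorem codeSize_cons (a : α) (l : List α) :
    codeSize (a :: l) = codeSize a + codeSize l + 1 := rfl

theorem one_le_codeSize (a : α) : 1 ≤ codeSize a := Data.one_le_size _

theorem length_lt_codeSize (l : List α) : l.length < codeSize l := by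
  induction l with
  | nil => simp [codeSize_nil]
  | cons a l ih => rw [List.length_cons, codeSize_cons]; lia

theorem codeSize_le_of_mem {l : List α} {a : α} (h : a ∈ l) : codeSize a ≤ codeSize l := by
  induction l with
  | nil => simp at h
  | cons b l ih =>
    rw [codeSize_cons]
    rcases List.mem_cons.1 h with rfl | h
    · lia
    · have := ih h
      lia

/-- The extra 1 is the terminating atom of `l`, which disappears in `l ++ m`. -/
theorem codeSize_append (l m : List α) :
    codeSize (l ++ m) + 1 = codeSize l + codeSize m := by
  induction l with
  | nil => simp [codeSize_nil, add_comm]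
  | cons a l ih => rw [List.cons_append, codeSize_cons, codeSize_cons]; lia

theorem codeSize_list_le {l : List α} {C : ℕ} (h : ∀ a ∈ l, codeSize a ≤ C) :
    codeSize l ≤ l.length * (C + 1) + 1 := by
  induction l with
  | nil => simp [codeSize_nil]
  | cons a l ih =>
    have h₁ := h a (by simp)
    have h₂ := ih fun b hb => h b (by simp [hb])
    rw [codeSize_cons, List.length_cons, add_mul]
    lia

theorem Nat.size_add_le (a b : ℕ) : (a + b).size ≤ max a.size b.size + 1 := by
  rw [Nat.size_le, pow_succ]
  have ha : a < 2 ^ max a.size b.size :=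
    a.lt_size_self.trans_le (Nat.pow_le_pow_right (by simp) (le_max_left _ _))
  have hb : b < 2 ^ max a.size b.size :=
    b.lt_size_self.trans_le (Nat.pow_le_pow_right (by simp) (le_max_right _ _))
  lia

theorem Nat.size_mul_le (a b : ℕ) : (a * b).size ≤ a.size + b.size := by
  rw [Nat.size_le, pow_add]
  exact Nat.mul_lt_mul'' a.lt_size_self b.lt_size_self

theorem codeSize_add_le (a b : ℤ) : codeSize (a + b) ≤ max (codeSize a) (codeSize b) + 1 := by
  simp only [codeSize_int]
  have := (Nat.size_le_size (Int.natAbs_add_le a b)).trans (Nat.size_add_le _ _)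
  lia

theorem codeSize_neg (a : ℤ) : codeSize (-a) = codeSize a := by
  simp [codeSize_int]

theorem codeSize_sub_le (a b : ℤ) : codeSize (a - b) ≤ max (codeSize a) (codeSize b) + 1 := by
  rw [sub_eq_add_neg, ← codeSize_neg b]
  exact codeSize_add_le _ _

theorem codeSize_mul_le (a b : ℤ) : codeSize (a * b) ≤ codeSize a + codeSize b := by
  simp only [codeSize_int, Int.natAbs_mul]
  have := Nat.size_mul_le a.natAbs b.natAbs
  lia

theorem codeSize_natCast_le (i : ℕ) : codeSize (i : ℤ) ≤ i + 1 := by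
  rw [codeSize_int, Int.natAbs_natCast, add_le_add_iff_right, Nat.size_le]
  exact Nat.lt_two_pow_self

/-- The entry of a list at an integer position, `d` if there is none. -/
def List.getInt {α : Type} (l : List α) (i : ℤ) (d : α) : α :=
  if 0 ≤ i then l.getD i.toNat d else d

/-- The sum of two fractions. -/
def intFracAdd (a b : ℤ × ℤ) : ℤ × ℤ := (a.1 * b.2 + b.1 * a.2, a.2 * b.2)

/-- The sum of a list of fractions. -/
def intFracSum (l : List (ℤ × ℤ)) : ℤ × ℤ := l.foldl intFracAdd (0, 1)

end Sizes

/-! ### Running times -/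

theorem Prog.Runs.input_size_le {p : Prog} {d r : Data} {t : ℕ} (h : p.Runs d r t) :
    d.size ≤ t := by
  induction h <;> lia

/-- Writing costs at least the size of what is written, so a polynomial cost bound also bounds the
output. Composition relies on this. -/
theorem Prog.Runs.output_size_le {p : Prog} {d r : Data} {t : ℕ} (h : p.Runs d r t) :
    r.size ≤ t := by
  induction h with
  | loop_done hc => exact hc.input_size_le.trans (Nat.le_succ _)
  | pair _ _ h₁ h₂ => simp only [Data.size]; lia
  | _ => lia

/-! ### Closure properties of polynomial-time functions -/

namespace PolyTime

variable {α β γ δ : Type} [Coded α] [Coded β] [Coded γ] [Coded δ]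

theorem intro {f : α → β} (p : Prog) {T : α → ℕ} (hT : PolyBounded T)
    (h : ∀ a, ∃ t, p.Runs (Coded.code a) (Coded.code (f a)) t ∧ t ≤ T a) : PolyTime f := by
  obtain ⟨P, hP⟩ := hT
  exact ⟨p, P, fun a => (h a).imp fun t ht => ⟨ht.1, ht.2.trans (hP a)⟩⟩

theorem exists_runs {f : α → β} (hf : PolyTime f) : ∃ (p : Prog) (T : α → ℕ), PolyBounded T ∧
    ∀ a, ∃ t, p.Runs (Coded.code a) (Coded.code (f a)) t ∧ t ≤ T a := by
  obtain ⟨p, P, h⟩ := hf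
  exact ⟨p, fun a => P.eval (codeSize a), PolyBounded.size.eval P, h⟩

theorem polyBounded {f : α → β} (hf : PolyTime f) : PolyBounded fun a => codeSize (f a) := by
  obtain ⟨p, P, h⟩ := hf
  refine ⟨P, fun a => ?_⟩
  obtain ⟨t, ht, htP⟩ := h a
  exact ht.output_size_le.trans htP

/-- A function is computed in polynomial time if this is so for its action on encodings. -/
theorem of_code {f : α → β} {F : γ → δ} (hF : PolyTime F) (ι : α → γ)
    (hι : ∀ a, Coded.code (ι a) = Coded.code a)
    (hf : ∀ a, Coded.code (F (ι a)) = Coded.code (f a)) : PolyTime f := by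
  obtain ⟨p, P, h⟩ := hF
  refine ⟨p, P, fun a => ?_⟩
  have := h (ι a)
  rwa [hι, hf] at this

theorem op {f : α → β} (o : Op) (h : ∀ a, o.run (Coded.code a) = Coded.code (f a))
    (hs : PolyBounded fun a => codeSize (f a)) : PolyTime f := by
  refine intro (.op o) (PolyBounded.size.add hs) fun a => ⟨_, ?_, le_rfl⟩
  have := Prog.Runs.op o (Coded.code a)
  rwa [h] at this

theorem id : PolyTime (fun a : α => a) := op .id (fun _ => rfl) PolyBounded.size

theorem const (b : β) : PolyTime fun _ : α => b :=
  op (.const (Coded.code b)) (fun _ => rfl) (PolyBounded.const _)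

theorem comp {g : β → γ} {f : α → β} (hg : PolyTime g) (hf : PolyTime f) :
    PolyTime fun a => g (f a) := by
  have hfs := hf.polyBounded
  obtain ⟨p, S, hS, hp⟩ := hf.exists_runs
  obtain ⟨q, T, hT, hq⟩ := hg.exists_runs
  refine intro (.seq p q) ((hS.add (hT.comp hfs)).add (.const 1)) fun a => ?_
  obtain ⟨s, hs, hsS⟩ := hp a
  obtain ⟨t, ht, htT⟩ := hq (f a)
  exact ⟨_, .seq hs ht, by lia⟩

theorem pair {f : α → β} {g : α → γ} (hf : PolyTime f) (hg : PolyTime g) :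
    PolyTime fun a => (f a, g a) := by
  obtain ⟨p, S, hS, hp⟩ := hf.exists_runs
  obtain ⟨q, T, hT, hq⟩ := hg.exists_runs
  refine intro (.pair p q) ((hS.add hT).add (.const 1)) fun a => ?_
  obtain ⟨s, hs, hsS⟩ := hp a
  obtain ⟨t, ht, htT⟩ := hq a
  exact ⟨_, .pair hs ht, by lia⟩

theorem cons {f : α → β} {g : α → List β} (hf : PolyTime f) (hg : PolyTime g) :
    PolyTime fun a => f a :: g a :=
  (pair hf hg).of_code (fun a => a) (fun _ => rfl) fun _ => rfl

theorem fst {f : α → β × γ} (hf : PolyTime f) : PolyTime fun a => (f a).1 :=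
  comp (g := fun b : β × γ => b.1) (op .fst (fun _ => rfl) (PolyBounded.size.mono fun a => by
    rw [show a = (a.1, a.2) from rfl, codeSize_pair]; lia)) hf

theorem snd {f : α → β × γ} (hf : PolyTime f) : PolyTime fun a => (f a).2 :=
  comp (g := fun b : β × γ => b.2) (op .snd (fun _ => rfl) (PolyBounded.size.mono fun a => by
    rw [show a = (a.1, a.2) from rfl, codeSize_pair]; lia)) hf

theorem arith {f g : α → ℤ} (hf : PolyTime f) (hg : PolyTime g) (o : Op) (F : ℤ → ℤ → ℤ)
    (h : ∀ a b, o.run (.pair (.int a) (.int b)) = .int (F a b))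
    (hs : ∀ a b, codeSize (F a b) ≤ codeSize a + codeSize b + 1) :
    PolyTime fun a => F (f a) (g a) :=
  comp (g := fun z : ℤ × ℤ => F z.1 z.2)
    (op o (fun z => h z.1 z.2) (PolyBounded.size.mono fun z => hs z.1 z.2)) (pair hf hg)

theorem add {f g : α → ℤ} (hf : PolyTime f) (hg : PolyTime g) : PolyTime fun a => f a + g a :=
  arith hf hg .add _ (fun _ _ => rfl) fun a b => (codeSize_add_le a b).trans (by lia)

theorem sub {f g : α → ℤ} (hf : PolyTime f) (hg : PolyTime g) : PolyTime fun a => f a - g a :=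
  arith hf hg .sub _ (fun _ _ => rfl) fun a b => (codeSize_sub_le a b).trans (by lia)

theorem mul {f g : α → ℤ} (hf : PolyTime f) (hg : PolyTime g) : PolyTime fun a => f a * g a :=
  arith hf hg .mul _ (fun _ _ => rfl) fun a b => (codeSize_mul_le a b).trans (by lia)

theorem ite_eq_zero {c : α → ℤ} {f g : α → β} (hc : PolyTime c) (hf : PolyTime f)
    (hg : PolyTime g) : PolyTime fun a => if c a = 0 then f a else g a := by
  obtain ⟨p, S, hS, hp⟩ := hc.exists_runs
  obtain ⟨q, T, hT, hq⟩ := hf.exists_runs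
  obtain ⟨r, U, hU, hr⟩ := hg.exists_runs
  -- The first branch of the language is taken on non-zero tests, hence the exchange of `q` and `r`.
  refine intro (.ite p r q) (((hS.add hT).add hU).add (.const 1)) fun a => ?_
  obtain ⟨s, hs, hsS⟩ := hp a
  obtain ⟨t, ht, htT⟩ := hq a
  obtain ⟨u, hu, huU⟩ := hr a
  by_cases h : c a = 0
  · rw [h] at hs
    simp only [h, if_true]
    exact ⟨_, .ite_false hs ht, by lia⟩
  · simp only [h, if_false]
    exact ⟨_, .ite_true hs (by simpa [code_int] using h) hu, by lia⟩

theorem ite_le {c d : α → ℤ} {f g : α → β} (hc : PolyTime c) (hd : PolyTime d) (hf : PolyTime f)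
    (hg : PolyTime g) : PolyTime fun a => if c a ≤ d a then f a else g a := by
  have h := ite_eq_zero (arith hc hd .le (fun a b => if a ≤ b then 1 else 0) (fun _ _ => rfl)
    fun a b => by
      have := one_le_codeSize a
      have := one_le_codeSize b
      split_ifs <;> simp [codeSize_int]; lia) hg hf
  convert h using 2 with a
  by_cases h : c a ≤ d a <;> simp [h]

theorem ite_eq {c d : α → ℤ} {f g : α → β} (hc : PolyTime c) (hd : PolyTime d) (hf : PolyTime f)
    (hg : PolyTime g) : PolyTime fun a => if c a = d a then f a else g a := by
  have h := ite_eq_zero (hc.sub hd) hf hg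
  simpa only [sub_eq_zero] using h

/-! ### Folding over lists -/

/-- The loop state consists of the context, the rest of the list and the accumulator. The rest
itself serves as the test, since its code is the atom `0` exactly when it is empty. `A` and `B`
bound the costs of test and body on states of size at most `M`. -/
theorem runs_foldl_loop {step : γ → β → α → β} {p q : Prog} {c : γ} {A B M : ℕ}
    (hp : ∀ (l : List α) (b : β), codeSize (c, l, b) ≤ M →
      ∃ t, p.Runs (Coded.code (c, l, b)) (Coded.code l) t ∧ t ≤ A)
    (hq : ∀ (x : α) (l : List α) (b : β), codeSize (c, x :: l, b) ≤ M →
      ∃ t, q.Runs (Coded.code (c, x :: l, b)) (Coded.code (c, l, step c b x)) t ∧ t ≤ B) :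
    ∀ (l : List α) (b : β),
      (∀ l₁ l₂, l₁ ++ l₂ = l → codeSize (c, l₂, l₁.foldl (step c) b) ≤ M) →
      ∃ t, (Prog.loop p q).Runs (Coded.code (c, l, b))
        (Coded.code (c, ([] : List α), l.foldl (step c) b)) t ∧
        t ≤ (l.length + 1) * (A + B + 1)
  | [], b, h => by
    obtain ⟨t, ht, htA⟩ := hp [] b (h [] [] rfl)
    exact ⟨_, .loop_done ht, by simp; lia⟩
  | x :: l, b, h => by
    have h₀ := h [] (x :: l) rfl
    obtain ⟨s, hs, hsA⟩ := hp (x :: l) b h₀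
    obtain ⟨t, ht, htB⟩ := hq x l b h₀
    obtain ⟨u, hu, huC⟩ := runs_foldl_loop hp hq l (step c b x) fun l₁ l₂ hl =>
      h (x :: l₁) l₂ (by simp [hl])
    refine ⟨_, .loop_step hs ?_ ht hu, ?_⟩
    · simp [code_cons]
    · rw [List.length_cons, add_mul (l.length + 1)]
      lia

/-- A polynomial-time step alone is not enough, because its iteration may square the state again and
again. The bound `B` on all intermediate accumulators excludes this. -/
theorem foldl_of_bound {step : γ → β → α → β} {l : γ → List α} {start : γ → β} {B : γ → ℕ}
    (hs : PolyTime fun s : γ × β × α => step s.1 s.2.1 s.2.2) (hl : PolyTime l)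
    (hi : PolyTime start) (hB : PolyBounded B)
    (h : ∀ c l₁, l₁ <+: l c → codeSize (l₁.foldl (step c) (start c)) ≤ B c) :
    PolyTime fun c => (l c).foldl (step c) (start c) := by
  have htest : PolyTime fun s : γ × List α × β => s.2.1 := id.snd.fst
  -- A non-empty list has the same code as the pair of its head and tail, so the body may be treated
  -- as a function of such a pair.
  have hbody : PolyTime fun s : γ × (α × List α) × β => (s.1, s.2.1.2, step s.1 s.2.2 s.2.1.1) :=
    pair id.fst (pair id.snd.fst.snd
      (hs.comp (f := fun s : γ × (α × List α) × β => (s.1, s.2.2, s.2.1.1))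
        (pair id.fst (pair id.snd.snd id.snd.fst.fst))))
  obtain ⟨p, P, hp⟩ := htest
  obtain ⟨q, Q, hq⟩ := hbody
  have hstart : PolyTime fun c => (c, l c, start c) := id.pair (hl.pair hi)
  obtain ⟨r, R, hR, hr⟩ := hstart.exists_runs
  have hend : PolyTime fun s : γ × List α × β => s.2.2 := id.snd.snd
  obtain ⟨e, E, he⟩ := hend
  set M : γ → ℕ := fun c => codeSize c + codeSize (l c) + B c + 2 with hM
  have hMb : PolyBounded M := (((PolyBounded.size).add hl.polyBounded).add hB).add (.const 2)
  refine intro (.seq r (.seq (.loop p q) e)) (T := fun c =>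
    R c + (codeSize (l c) * (P.eval (M c) + Q.eval (M c) + 1) + E.eval (M c) + 1) + 1)
    ((hR.add (((hl.polyBounded.mul (((hMb.eval P).add (hMb.eval Q)).add (.const 1))).add
      (hMb.eval E)).add (.const 1))).add (.const 1)) fun c => ?_
  have key : ∀ l₁ l₂, l₁ ++ l₂ = l c →
      codeSize (c, l₂, l₁.foldl (step c) (start c)) ≤ M c := by
    intro l₁ l₂ hl
    have h₁ := h c l₁ ⟨l₂, hl⟩
    have h₂ := codeSize_append l₁ l₂
    have h₃ := one_le_codeSize l₁
    rw [hl] at h₂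
    simp only [codeSize_pair, hM]
    lia
  obtain ⟨t₁, ht₁, hb₁⟩ := hr c
  obtain ⟨t₂, ht₂, hb₂⟩ := runs_foldl_loop (step := step) (p := p) (q := q) (c := c)
    (A := P.eval (M c)) (B := Q.eval (M c)) (M := M c)
    (fun l' b hle => by
      obtain ⟨t, ht, htP⟩ := hp (c, l', b)
      exact ⟨t, ht, htP.trans (P.eval_mono_nat hle)⟩)
    (fun x l' b hle => by
      obtain ⟨t, ht, htQ⟩ := hq (c, (x, l'), b)
      exact ⟨t, ht, htQ.trans (Q.eval_mono_nat hle)⟩) (l c) (start c) key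
  obtain ⟨t₃, ht₃, hb₃⟩ := he (c, [], (l c).foldl (step c) (start c))
  refine ⟨_, .seq ht₁ (.seq ht₂ ht₃), ?_⟩
  have h₄ : t₃ ≤ E.eval (M c) := hb₃.trans (E.eval_mono_nat (key (l c) [] (by simp)))
  have h₅ : t₂ ≤ codeSize (l c) * (P.eval (M c) + Q.eval (M c) + 1) :=
    hb₂.trans (Nat.mul_le_mul_right _ (length_lt_codeSize (l c)))
  lia

/-- Folding is possible in polynomial time if every step increases the size `μ` of the state at
most by an amount that does not depend on the state. -/
theorem foldl {step : γ → β → α → β} {l : γ → List α} {start : γ → β}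
    (hs : PolyTime fun s : γ × β × α => step s.1 s.2.1 s.2.2) (hl : PolyTime l)
    (hi : PolyTime start) (μ : β → ℕ) (C : ℕ) {A : γ → ℕ} (hA : PolyBounded A)
    (hle : ∀ b, codeSize b ≤ C * μ b + C) (hge : ∀ b, μ b ≤ codeSize b)
    (h : ∀ c b x, x ∈ l c → μ (step c b x) ≤ μ b + A c) :
    PolyTime fun c => (l c).foldl (step c) (start c) := by
  refine foldl_of_bound hs hl hi (B := fun c =>
    C * (codeSize (start c) + codeSize (l c) * A c) + C)
    ((((PolyBounded.const C).mul (hi.polyBounded.add (hl.polyBounded.mul hA)))).add (.const C))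
    fun c l₁ hl₁ => (hle _).trans ?_
  have key : ∀ (l₂ : List α) (b : β), (∀ x ∈ l₂, x ∈ l c) →
      μ (l₂.foldl (step c) b) ≤ μ b + l₂.length * A c := by
    intro l₂
    induction l₂ with
    | nil => simp
    | cons x l₂ ih =>
      intro b hx
      have h₁ := ih (step c b x) fun y hy => hx y (by simp [hy])
      have h₂ := h c b x (hx x (by simp))
      rw [List.foldl_cons, List.length_cons, add_mul]
      lia
  have h₁ := key l₁ (start c) fun x hx => hl₁.subset hx
  have h₂ := hge (start c)
  have h₃ : l₁.length * A c ≤ codeSize (l c) * A c :=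
    Nat.mul_le_mul_right _ (hl₁.length_le.trans (length_lt_codeSize _).le)
  gcongr
  lia

/-! ### Polynomial-time operations on lists -/

theorem reverse {l : γ → List α} (hl : PolyTime l) : PolyTime fun c => (l c).reverse := by
  have h := foldl (step := fun (_ : γ) (b : List α) x => x :: b) (start := fun _ => [])
    (cons id.snd.snd id.snd.fst) hl (const []) codeSize 1 (hl.polyBounded.add (.const 1))
    (fun b => by lia) (fun b => le_rfl) fun c b x hx => by
      have := codeSize_le_of_mem hx
      rw [codeSize_cons]
      lia
  simpa using h

/-- Results are collected in reverse order. The function `step` is a separate argument because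
values of `f` are options, which have no encoding. -/
theorem filterMap {l : γ → List α} {f : γ → α → Option β} {step : γ → List β → α → List β}
    (hl : PolyTime l) (hs : PolyTime fun s : γ × List β × α => step s.1 s.2.1 s.2.2)
    {A : γ → ℕ} (hA : PolyBounded A)
    (h : ∀ c b x, x ∈ l c → step c b x = ((f c x).toList ++ b))
    (hf : ∀ c x y, x ∈ l c → f c x = some y → codeSize y ≤ A c) :
    PolyTime fun c => (l c).filterMap (f c) := by
  have h₁ := (foldl (start := fun _ => []) hs hl (const []) codeSize 1 (hA.add (.const 1))
    (fun b => by lia) (fun b => le_rfl) fun c b x hx => by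
      rw [h c b x hx]
      have := codeSize_append (f c x).toList b
      cases hy : f c x with
      | none => simp
      | some y =>
        have := hf c x y hx hy
        simp only [Option.toList_some, List.cons_append, List.nil_append, codeSize_cons]
        lia).reverse
  convert h₁ using 2 with c
  have key : ∀ (l' : List α) (b : List β), (∀ x ∈ l', x ∈ l c) →
      (l'.foldl (step c) b).reverse = b.reverse ++ l'.filterMap (f c) := by
    intro l'
    induction l' with
    | nil => simp
    | cons x l' ih =>
      intro b hx
      rw [List.foldl_cons, ih _ fun y hy => hx y (by simp [hy]), h c b x (hx x (by simp))]
      cases hy : f c x <;> simp [hy]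
  simpa using (key (l c) [] fun x hx => hx).symm

theorem map {l : γ → List α} {f : γ → α → β} (hl : PolyTime l)
    (hf : PolyTime fun s : γ × α => f s.1 s.2) : PolyTime fun c => (l c).map (f c) := by
  obtain ⟨P, hP⟩ := hf.polyBounded
  have h := filterMap (f := fun c x => some (f c x)) (step := fun c b x => f c x :: b) hl
    (cons (hf.comp (f := fun s : γ × List β × α => (s.1, s.2.2)) (pair id.fst id.snd.snd))
      id.snd.fst)
    (((PolyBounded.size.add hl.polyBounded).add (.const 1)).eval P)
    (fun c b x _ => by simp) fun c x y hx hy => by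
      obtain rfl := Option.some.inj hy
      refine (hP (c, x)).trans (P.eval_mono_nat ?_)
      have := codeSize_le_of_mem hx
      rw [codeSize_pair]
      lia
  simpa only [List.filterMap_eq_map'] using h

theorem append {l m : γ → List α} (hl : PolyTime l) (hm : PolyTime m) :
    PolyTime fun c => l c ++ m c := by
  have h := foldl (step := fun (_ : γ) (b : List α) x => x :: b) (start := m)
    (cons id.snd.snd id.snd.fst) hl.reverse hm codeSize 1 (hl.reverse.polyBounded.add (.const 1))
    (fun b => by lia) (fun b => le_rfl) fun c b x hx => by
      have := codeSize_le_of_mem hx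
      rw [codeSize_cons]
      lia
  simpa using h

theorem sum {l : γ → List ℤ} (hl : PolyTime l) : PolyTime fun c => (l c).sum := by
  have h := foldl (step := fun (_ : γ) (b : ℤ) x => b + x) (start := fun _ => 0)
    (add id.snd.fst id.snd.snd) hl (const 0) codeSize 1 (hl.polyBounded.add (.const 1))
    (fun b => by lia) (fun b => le_rfl) fun c b x hx => by
      have := codeSize_le_of_mem hx
      have := codeSize_add_le b x
      lia
  simpa only [← List.sum_eq_foldl] using h

theorem length {l : γ → List α} (hl : PolyTime l) : PolyTime fun c => ((l c).length : ℤ) := by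
  simpa using (map (f := fun _ _ => (1 : ℤ)) hl (const 1)).sum

/-- The range is bounded by the length of a list, not by a number in binary, for which the output
could be exponentially long. -/
theorem range_length {l : γ → List α} (hl : PolyTime l) :
    PolyTime fun c => (List.range (l c).length).map (fun i : ℕ => (i : ℤ)) := by
  have key : ∀ l' : List α, l'.foldl (fun (b : ℤ × List ℤ) _ => (b.1 + 1, b.1 :: b.2)) (0, []) =
      ((l'.length : ℤ), ((List.range l'.length).map fun i : ℕ => (i : ℤ)).reverse) := by
    intro l'
    induction l' using List.reverseRecOn with
    | nil => simp
    | append_singleton l' x ih => simp [ih, List.range_succ]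
  have h := foldl_of_bound (step := fun (_ : γ) (b : ℤ × List ℤ) (_ : α) => (b.1 + 1, b.1 :: b.2))
    (start := fun _ => (0, [])) (B := fun c => codeSize (l c) * (codeSize (l c) + 5) + 5)
    (pair (add id.snd.fst.fst (const 1)) (cons id.snd.fst.fst id.snd.fst.snd)) hl (const _)
    ((hl.polyBounded.mul (hl.polyBounded.add (.const 5))).add (.const 5)) fun c l₁ h₁ => by
      rw [key, codeSize_pair]
      have hlen : l₁.length < codeSize (l c) := h₁.length_le.trans_lt (length_lt_codeSize _)
      have h₂ := codeSize_list_le (l := ((List.range l₁.length).map fun i : ℕ => (i : ℤ)).reverse)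
        (C := l₁.length) fun a ha => by
          simp only [List.mem_reverse, List.mem_map, List.mem_range] at ha
          obtain ⟨i, hi, rfl⟩ := ha
          exact (codeSize_natCast_le i).trans hi
      have h₃ := codeSize_natCast_le l₁.length
      simp only [List.length_reverse, List.length_map, List.length_range] at h₂
      nlinarith
  simp only [key] at h
  simpa using h.snd.reverse

/-- Linear scan: the state is a counter together with the entry found so far, initially `d`. -/
theorem getInt {l : γ → List α} {i : γ → ℤ} (hl : PolyTime l) (hi : PolyTime i) (d : α) :
    PolyTime fun c => (l c).getInt (i c) d := by
  have key : ∀ (l' : List α) (i : ℤ),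
      l'.foldl (fun (b : ℤ × α) x => (b.1 + 1, if b.1 = i then x else b.2)) (0, d) =
      ((l'.length : ℤ), l'.getInt i d) := by
    intro l' i
    induction l' using List.reverseRecOn with
    | nil => simp [List.getInt]
    | append_singleton l' x ih =>
      rw [List.foldl_append, ih]
      simp only [List.foldl_cons, List.foldl_nil, List.length_append, List.length_singleton,
        Nat.cast_add, Nat.cast_one, List.getInt, Prod.mk.injEq, true_and]
      by_cases h0 : 0 ≤ i
      · lift i to ℕ using h0
        rcases lt_trichotomy l'.length i with h | rfl | h
        · have h₁ : l'.length ≠ i := h.ne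
          simp [h.le, h₁, List.getElem?_eq_none (l := l' ++ [x]) (i := i) (by simp; lia)]
        · simp
        · have h₁ : l'.length ≠ i := h.ne'
          simp [h₁, List.getElem?_append_left h]
      · have h₁ : (l'.length : ℤ) ≠ i := by lia
        simp [h0, h₁]
  have hmem : ∀ (l' : List α) (i : ℤ), codeSize (l'.getInt i d) ≤ codeSize d + codeSize l' := by
    intro l' i
    simp only [List.getInt]
    split_ifs
    · by_cases h : i.toNat < l'.length
      · have := codeSize_le_of_mem (List.getElem_mem h)
        rw [List.getD_eq_getElem _ _ h]
        lia
      · rw [List.getD_eq_default _ _ (by lia)]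
        lia
    · lia
  have h := foldl_of_bound (B := fun c => codeSize d + 2 * codeSize (l c) + 3)
    (step := fun (c : γ) (b : ℤ × α) (x : α) => (b.1 + 1, if b.1 = i c then x else b.2))
    (start := fun _ => (0, d))
    (pair (add id.snd.fst.fst (const 1))
      (ite_eq id.snd.fst.fst (hi.comp id.fst) id.snd.snd id.snd.fst.snd)) hl (const _)
    (((PolyBounded.const _).add ((PolyBounded.const 2).mul hl.polyBounded)).add (.const 3))
    fun c l₁ h₁ => by
      obtain ⟨l₂, hl₂⟩ := h₁
      have h₂ := codeSize_append l₁ l₂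
      have h₃ := hmem l₁ (i c)
      have h₄ : codeSize (l₁.length : ℤ) ≤ l₁.length + 1 := codeSize_natCast_le _
      have h₅ := length_lt_codeSize l₁
      have h₆ := one_le_codeSize l₂
      rw [key, codeSize_pair, ← hl₂]
      lia
  simp only [key] at h
  exact h.snd

theorem filterMap_ite_le {l : γ → List α} {i j : γ → α → ℤ} {g : γ → α → β} (hl : PolyTime l)
    (hi : PolyTime fun s : γ × α => i s.1 s.2) (hj : PolyTime fun s : γ × α => j s.1 s.2)
    (hg : PolyTime fun s : γ × α => g s.1 s.2) :
    PolyTime fun c => (l c).filterMap fun x => if i c x ≤ j c x then some (g c x) else none := by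
  have hp : PolyTime fun s : γ × List β × α => (s.1, s.2.2) := pair id.fst id.snd.snd
  obtain ⟨P, hP⟩ := hg.polyBounded
  refine filterMap (step := fun c b x => if i c x ≤ j c x then g c x :: b else b) hl
    (ite_le (hi.comp hp) (hj.comp hp) (cons (hg.comp hp) id.snd.fst) id.snd.fst)
    (((PolyBounded.size.add hl.polyBounded).add (.const 1)).eval P)
    (fun c b x _ => by split_ifs <;> simp) fun c x y hx hy => ?_
  split_ifs at hy
  obtain rfl := Option.some.inj hy
  refine (hP (c, x)).trans (P.eval_mono_nat ?_)
  have := codeSize_le_of_mem hx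
  rw [codeSize_pair]
  lia

/-- The potential is the larger of the sizes of numerator and denominator. Adding a fraction raises
it by little more than the size of that fraction, whereas the size of the pair need not grow by an
amount independent of the state. -/
theorem fracSum {l : γ → List (ℤ × ℤ)} (hl : PolyTime l) :
    PolyTime fun c => intFracSum (l c) := by
  refine foldl (step := fun (_ : γ) b x => intFracAdd b x) (start := fun _ => ((0 : ℤ), (1 : ℤ)))
    (pair (add (mul id.snd.fst.fst id.snd.snd.snd) (mul id.snd.snd.fst id.snd.fst.snd))
      (mul id.snd.fst.snd id.snd.snd.snd)) hl (const _)
    (fun b => max (codeSize b.1) (codeSize b.2)) 2 (hl.polyBounded.add (.const 1))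
    (fun b => ?_) (fun b => ?_) fun c b x hx => ?_
  · rw [show b = (b.1, b.2) from rfl, codeSize_pair]
    lia
  · rw [show codeSize b = codeSize b.1 + codeSize b.2 + 1 from rfl]
    lia
  · have h := codeSize_le_of_mem hx
    rw [show codeSize x = codeSize x.1 + codeSize x.2 + 1 from rfl] at h
    have h₁ := codeSize_mul_le b.1 x.2
    have h₂ := codeSize_mul_le x.1 b.2
    have h₃ := codeSize_mul_le b.2 x.2
    have h₄ := codeSize_add_le (b.1 * x.2) (x.1 * b.2)
    simp only [intFracAdd]
    lia

theorem abs {f : α → ℤ} (hf : PolyTime f) : PolyTime fun a => |f a| := by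
  have h := ite_le (const 0) hf hf (sub (const 0) hf)
  convert h using 2 with a
  split_ifs with h
  · exact abs_of_nonneg h
  · rw [abs_of_neg (not_le.1 h), zero_sub]

end PolyTime

end

noncomputable section

/-! ### Pendant extensions

A partitioned matching game is modelled by a `b`-matching game on its vertices and players. If parts
of size at least two occur, every vertex is joined to its player by an edge of large weight. -/

section PendantExtension

set_option linter.unusedSectionVars false

open Classical

variable {V N X : Type*}

theorem noCommonEnd_iff_card_le_one {M : Finset (Sym2 V)} :
    NoCommonEnd M ↔ ∀ u, (M.filter fun e => u ∈ e).card ≤ 1 := by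
  simp only [Finset.card_le_one, Finset.mem_filter, NoCommonEnd]
  constructor
  · rintro h u e ⟨he, hu⟩ f ⟨hf, hv⟩
    by_contra hef
    exact h e he f hf hef u hu hv
  · intro h e he f hf hef u hu hv
    exact hef (h u e ⟨he, hu⟩ f ⟨hf, hv⟩)

theorem maxMatching_nonneg [Fintype V] (G : SimpleGraph V) (w : Sym2 V → ℝ) (S : Finset V) :
    0 ≤ maxMatching G w S :=
  Finset.le_sup'_of_le _ (empty_mem_matchingsOn G S) (by simp)

theorem le_maxMatching [Fintype V] {G : SimpleGraph V} {w : Sym2 V → ℝ} {S : Finset V}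
    {M : Finset (Sym2 V)} (h₁ : EdgesWithin G S M) (h₂ : NoCommonEnd M) :
    ∑ e ∈ M, w e ≤ maxMatching G w S :=
  Finset.le_sup' (fun M => ∑ e ∈ M, w e) (Finset.mem_filter.2 ⟨Finset.mem_univ _, h₁, h₂⟩)

theorem maxMatching_le [Fintype V] {G : SimpleGraph V} {w : Sym2 V → ℝ} {S : Finset V} {c : ℝ}
    (h : ∀ M, EdgesWithin G S M → NoCommonEnd M → ∑ e ∈ M, w e ≤ c) :
    maxMatching G w S ≤ c :=
  Finset.sup'_le _ _ fun M hM => h M (Finset.mem_filter.1 hM).2.1 (Finset.mem_filter.1 hM).2.2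

/-- The edge between the vertex `u` and its player. -/
def pendantEdge (part : V → N) (ι : V ↪ X) (κ : N ↪ X) (u : V) : Sym2 X := s(ι u, κ (part u))

/-- The graph `H` with weights `w'` consists of a copy of the weighted graph `(G, w)`, a vertex for
each player, and, if `wide` holds, an edge of weight `W` between each vertex and its player. -/
structure IsPendantExtension (wide : Prop) (G : SimpleGraph V) (w : Sym2 V → ℝ) (part : V → N)
    (W : ℝ) (ι : V ↪ X) (κ : N ↪ X) (H : SimpleGraph X) (w' : Sym2 X → ℝ) : Prop where
  ne : ∀ u p, ι u ≠ κ p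
  cover : ∀ x, (∃ u, ι u = x) ∨ ∃ p, κ p = x
  mem_edgeSet : ∀ e, e ∈ H.edgeSet ↔
    (∃ f ∈ G.edgeSet, f.map ι = e) ∨ wide ∧ ∃ u, pendantEdge part ι κ u = e
  weight_map : ∀ e ∈ G.edgeSet, w' (e.map ι) = w e
  weight_pendant : wide → ∀ u, w' (pendantEdge part ι κ u) = W

namespace IsPendantExtension

variable {wide : Prop} {G : SimpleGraph V} {w : Sym2 V → ℝ} {part : V → N} {W : ℝ} {ι : V ↪ X}
  {κ : N ↪ X} {H : SimpleGraph X} {w' : Sym2 X → ℝ}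

/-! ### Edge sets of the extension as pairs `(M, U)` -/

theorem mem_map_iff (u : V) (e : Sym2 V) : ι u ∈ e.map ι ↔ u ∈ e := by
  simp [Sym2.mem_map]

theorem mem_pendantEdge (h : IsPendantExtension wide G w part W ι κ H w') (u v : V) :
    ι u ∈ pendantEdge part ι κ v ↔ v = u := by
  simp [pendantEdge, Sym2.mem_iff, h.ne, eq_comm]

theorem player_notMem_map (h : IsPendantExtension wide G w part W ι κ H w') (p : N) (e : Sym2 V) :
    κ p ∉ e.map ι := by
  simp [Sym2.mem_map, h.ne]

theorem player_mem_pendantEdge (h : IsPendantExtension wide G w part W ι κ H w') (p : N) (u : V) :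
    κ p ∈ pendantEdge part ι κ u ↔ part u = p := by
  simp [pendantEdge, Sym2.mem_iff, (h.ne _ _).symm, eq_comm]

theorem pendantEdge_injective (h : IsPendantExtension wide G w part W ι κ H w') :
    Function.Injective (pendantEdge part ι κ) := by
  intro u v huv
  have : ι u ∈ pendantEdge part ι κ v := huv ▸ (h.mem_pendantEdge u u).2 rfl
  exact ((h.mem_pendantEdge u v).1 this).symm

variable (part ι κ) in
/-- The set of edges that consists of the copies of `M` and the pendant edges at `U`. -/
def lift (M : Finset (Sym2 V)) (U : Finset V) : Finset (Sym2 X) :=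
  M.image (Sym2.map ι) ∪ U.image (pendantEdge part ι κ)

theorem disjoint_images (h : IsPendantExtension wide G w part W ι κ H w') (M : Finset (Sym2 V))
    (U : Finset V) : Disjoint (M.image (Sym2.map ι)) (U.image (pendantEdge part ι κ)) := by
  rw [Finset.disjoint_left]
  rintro _ he hf
  obtain ⟨e, -, rfl⟩ := Finset.mem_image.1 he
  obtain ⟨u, -, hu⟩ := Finset.mem_image.1 hf
  exact h.player_notMem_map (part u) e (hu ▸ (h.player_mem_pendantEdge _ u).2 rfl)

/-- The lifts are the `b`-matchings whose edges are described by `M` and `U`. -/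
structure Admissible (wide : Prop) (G : SimpleGraph V) (part : V → N) (ι : V ↪ X) (κ : N ↪ X)
    (b : X → ℕ+) (S : Finset X) (M : Finset (Sym2 V)) (U : Finset V) : Prop where
  edge : ∀ e ∈ M, e ∈ G.edgeSet
  mem : ∀ e ∈ M, ∀ u ∈ e, ι u ∈ S
  wide : ∀ u ∈ U, wide
  vertex_mem : ∀ u ∈ U, ι u ∈ S
  player_mem : ∀ u ∈ U, κ (part u) ∈ S
  card_vertex : ∀ u, (M.filter fun e => u ∈ e).card + (if u ∈ U then 1 else 0) ≤ (b (ι u) : ℕ)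
  card_player : ∀ p, (U.filter fun u => part u = p).card ≤ (b (κ p) : ℕ)

theorem sum_lift (h : IsPendantExtension wide G w part W ι κ H w') {M : Finset (Sym2 V)}
    {U : Finset V} (hM : ∀ e ∈ M, e ∈ G.edgeSet) (hU : ∀ u ∈ U, wide) :
    ∑ e ∈ lift part ι κ M U, w' e = ∑ e ∈ M, w e + U.card * W := by
  rw [lift, Finset.sum_union (h.disjoint_images M U),
    Finset.sum_image (Sym2.map.injective ι.injective).injOn,
    Finset.sum_image h.pendantEdge_injective.injOn,
    Finset.sum_congr rfl fun e he => h.weight_map e (hM e he),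
    Finset.sum_congr rfl fun u hu => h.weight_pendant (hU u hu) u]
  simp

theorem card_filter_vertex (h : IsPendantExtension wide G w part W ι κ H w')
    (M : Finset (Sym2 V)) (U : Finset V) (u : V) :
    ((lift part ι κ M U).filter fun e => ι u ∈ e).card =
      (M.filter fun e => u ∈ e).card + (if u ∈ U then 1 else 0) := by
  rw [lift, Finset.filter_union, Finset.card_union_of_disjoint
    (Finset.disjoint_filter_filter (h.disjoint_images M U)), Finset.filter_image,
    Finset.filter_image, Finset.card_image_of_injective _ (Sym2.map.injective ι.injective),
    Finset.card_image_of_injective _ h.pendantEdge_injective]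
  simp only [mem_map_iff, h.mem_pendantEdge]
  congr 1
  split_ifs with hu
  · exact Finset.card_eq_one.2 ⟨u, by
      ext v
      simp only [Finset.mem_filter, Finset.mem_singleton]
      exact ⟨fun hv => hv.2, fun hv => ⟨hv ▸ hu, hv⟩⟩⟩
  · refine Finset.card_eq_zero.2 (Finset.filter_eq_empty_iff.2 fun v hv hvu => hu (hvu ▸ hv))

theorem card_filter_player (h : IsPendantExtension wide G w part W ι κ H w')
    (M : Finset (Sym2 V)) (U : Finset V) (p : N) :
    ((lift part ι κ M U).filter fun e => κ p ∈ e).card =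
      (U.filter fun u => part u = p).card := by
  rw [lift, Finset.filter_union, Finset.card_union_of_disjoint
    (Finset.disjoint_filter_filter (h.disjoint_images M U)), Finset.filter_image,
    Finset.filter_image, Finset.card_image_of_injective _ (Sym2.map.injective ι.injective),
    Finset.card_image_of_injective _ h.pendantEdge_injective]
  simp only [h.player_notMem_map, h.player_mem_pendantEdge]
  simp

theorem admissible_iff (h : IsPendantExtension wide G w part W ι κ H w') {b : X → ℕ+}
    {S : Finset X} {M : Finset (Sym2 V)} {U : Finset V} (hM : ∀ e ∈ M, e ∈ G.edgeSet)
    (hU : ∀ u ∈ U, wide) :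
    Admissible wide G part ι κ b S M U ↔
      EdgesWithin H S (lift part ι κ M U) ∧ RespectsCapacity b (lift part ι κ M U) := by
  have hcap : RespectsCapacity b (lift part ι κ M U) ↔
      (∀ u, (M.filter fun e => u ∈ e).card + (if u ∈ U then 1 else 0) ≤ (b (ι u) : ℕ)) ∧
      ∀ p, (U.filter fun u => part u = p).card ≤ (b (κ p) : ℕ) := by
    simp only [← h.card_filter_vertex, ← h.card_filter_player M]
    refine ⟨fun hb => ⟨fun u => hb _, fun p => hb _⟩, fun hb x => ?_⟩
    obtain ⟨u, rfl⟩ | ⟨p, rfl⟩ := h.cover x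
    · exact hb.1 u
    · exact hb.2 p
  rw [hcap]
  constructor
  · intro ha
    refine ⟨fun e he => ?_, ha.card_vertex, ha.card_player⟩
    rcases Finset.mem_union.1 he with he | he <;> obtain ⟨f, hf, rfl⟩ := Finset.mem_image.1 he
    · refine ⟨(h.mem_edgeSet _).2 (.inl ⟨f, hM f hf, rfl⟩), fun x hx => ?_⟩
      obtain ⟨u, hu, rfl⟩ := Sym2.mem_map.1 hx
      exact ha.mem f hf u hu
    · refine ⟨(h.mem_edgeSet _).2 (.inr ⟨hU f hf, f, rfl⟩), fun x hx => ?_⟩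
      rcases Sym2.mem_iff.1 hx with rfl | rfl
      · exact ha.vertex_mem f hf
      · exact ha.player_mem f hf
  · rintro ⟨he, h₁, h₂⟩
    refine ⟨hM, fun e heM u hu => ?_, hU, fun u hu => ?_, fun u hu => ?_, h₁, h₂⟩
    · exact (he _ (Finset.mem_union_left _ (Finset.mem_image_of_mem _ heM))).2 _
        ((mem_map_iff u e).2 hu)
    · exact (he _ (Finset.mem_union_right _ (Finset.mem_image_of_mem _ hu))).2 _
        (Sym2.mem_mk_left _ _)
    · exact (he _ (Finset.mem_union_right _ (Finset.mem_image_of_mem _ hu))).2 _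
        (Sym2.mem_mk_right _ _)

/-! ### Values and payments of coalitions of the extension -/

variable [Fintype V] [Fintype N] [Fintype X]

theorem le_maxBMatching (h : IsPendantExtension wide G w part W ι κ H w') {b : X → ℕ+}
    {S : Finset X} {M : Finset (Sym2 V)} {U : Finset V}
    (ha : Admissible wide G part ι κ b S M U) :
    ∑ e ∈ M, w e + U.card * W ≤ maxBMatching H b w' S := by
  rw [← h.sum_lift ha.edge ha.wide]
  exact Finset.le_sup' (fun M => ∑ e ∈ M, w' e)
    (Finset.mem_filter.2 ⟨Finset.mem_univ _, (h.admissible_iff ha.edge ha.wide).1 ha⟩)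

/-- Every set of edges of `H` is a lift: `M` and `U` are read off from the copies and the pendant
edges that it contains. -/
theorem maxBMatching_le (h : IsPendantExtension wide G w part W ι κ H w') {b : X → ℕ+}
    {S : Finset X} {c : ℝ}
    (hc : ∀ M U, Admissible wide G part ι κ b S M U → ∑ e ∈ M, w e + U.card * W ≤ c) :
    maxBMatching H b w' S ≤ c := by
  refine Finset.sup'_le _ _ fun L hL => ?_
  have hL := (Finset.mem_filter.1 hL).2
  set M : Finset (Sym2 V) := Finset.univ.filter fun e => e ∈ G.edgeSet ∧ e.map ι ∈ L
  set U : Finset V := Finset.univ.filter fun u => wide ∧ pendantEdge part ι κ u ∈ L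
  have hM : ∀ e ∈ M, e ∈ G.edgeSet := fun e he => (Finset.mem_filter.1 he).2.1
  have hU : ∀ u ∈ U, wide := fun u hu => (Finset.mem_filter.1 hu).2.1
  have key : lift part ι κ M U = L := by
    ext e
    simp only [lift, Finset.mem_union, Finset.mem_image, M, U, Finset.mem_filter,
      Finset.mem_univ, true_and]
    constructor
    · rintro (⟨f, hf, rfl⟩ | ⟨u, hu, rfl⟩)
      exacts [hf.2, hu.2]
    · intro he
      rcases (h.mem_edgeSet e).1 (hL.1 e he).1 with ⟨f, hf, rfl⟩ | ⟨hw, u, rfl⟩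
      exacts [.inl ⟨f, ⟨hf, he⟩, rfl⟩, .inr ⟨u, ⟨hw, he⟩, rfl⟩]
  rw [← key, h.sum_lift hM hU]
  exact hc M U ((h.admissible_iff hM hU).2 (key ▸ hL))

/-- The vertices of `G` whose copies belong to `S`. -/
def vertices (ι : V ↪ X) (S : Finset X) : Finset V := Finset.univ.filter fun u => ι u ∈ S

/-- The players of the coalition `S`. -/
def players (κ : N ↪ X) (S : Finset X) : Finset N := Finset.univ.filter fun p => κ p ∈ S

/-- The vertices that belong to the players of `T`. -/
def owned (part : V → N) (T : Finset N) : Finset V := Finset.univ.filter fun u => part u ∈ T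

/-- The players of `T` together with their vertices. -/
def fullCoalition (part : V → N) (ι : V ↪ X) (κ : N ↪ X) (T : Finset N) : Finset X :=
  (owned part T).map ι ∪ T.map κ

theorem mem_vertices {S : Finset X} {u : V} : u ∈ vertices ι S ↔ ι u ∈ S := by simp [vertices]

theorem mem_owned {T : Finset N} {u : V} : u ∈ owned part T ↔ part u ∈ T := by simp [owned]

theorem mem_players {S : Finset X} {p : N} : p ∈ players κ S ↔ κ p ∈ S := by simp [players]

theorem disjoint_maps (h : IsPendantExtension wide G w part W ι κ H w') (A : Finset V)
    (T : Finset N) : Disjoint (A.map ι) (T.map κ) := by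
  rw [Finset.disjoint_left]
  rintro _ hx hy
  obtain ⟨u, -, rfl⟩ := Finset.mem_map.1 hx
  obtain ⟨p, -, hp⟩ := Finset.mem_map.1 hy
  exact h.ne u p hp.symm

theorem eq_union (h : IsPendantExtension wide G w part W ι κ H w') (S : Finset X) :
    S = (vertices ι S).map ι ∪ (players κ S).map κ := by
  ext x
  simp only [Finset.mem_union, Finset.mem_map, mem_vertices, mem_players]
  constructor
  · intro hx
    obtain ⟨u, rfl⟩ | ⟨p, rfl⟩ := h.cover x
    exacts [.inl ⟨u, hx, rfl⟩, .inr ⟨p, hx, rfl⟩]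
  · rintro (⟨u, hu, rfl⟩ | ⟨p, hp, rfl⟩) <;> assumption

theorem sum_eq (h : IsPendantExtension wide G w part W ι κ H w') (S : Finset X) (f : X → ℝ) :
    ∑ x ∈ S, f x = ∑ u ∈ vertices ι S, f (ι u) + ∑ p ∈ players κ S, f (κ p) := by
  conv_lhs => rw [h.eq_union S]
  rw [Finset.sum_union (h.disjoint_maps _ _), Finset.sum_map, Finset.sum_map]

theorem vertices_fullCoalition (h : IsPendantExtension wide G w part W ι κ H w') (T : Finset N) :
    vertices ι (fullCoalition part ι κ T) = owned part T := by
  ext u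
  simp [mem_vertices, fullCoalition, (h.ne _ _).symm]

theorem players_fullCoalition (h : IsPendantExtension wide G w part W ι κ H w') (T : Finset N) :
    players κ (fullCoalition part ι κ T) = T := by
  ext u
  simp [mem_players, fullCoalition, h.ne]

theorem fullCoalition_univ (h : IsPendantExtension wide G w part W ι κ H w') :
    fullCoalition part ι κ Finset.univ = Finset.univ := by
  ext x
  obtain ⟨u, rfl⟩ | ⟨p, rfl⟩ := h.cover x <;> simp [fullCoalition, owned]

theorem sum_owned (T : Finset N) (f : V → ℝ) :
    ∑ u ∈ owned part T, f u = ∑ p ∈ T, ∑ u with part u = p, f u := by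
  rw [← Finset.sum_fiberwise_of_maps_to (s := owned part T) (t := T) (g := part)
    fun u hu => mem_owned.1 hu]
  refine Finset.sum_congr rfl fun p hp => Finset.sum_congr ?_ fun _ _ => rfl
  ext u
  simp only [Finset.mem_filter, mem_owned, Finset.mem_univ, true_and]
  exact ⟨fun h => h.2, fun h => ⟨h ▸ hp, h⟩⟩

theorem card_owned (T : Finset N) :
    ((owned part T).card : ℝ) = ∑ p ∈ T, ((Finset.univ.filter fun u => part u = p).card : ℝ) := by
  simpa using sum_owned (part := part) T fun _ => (1 : ℝ)

theorem sum_fullCoalition (h : IsPendantExtension wide G w part W ι κ H w') (T : Finset N)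
    (f : X → ℝ) : ∑ x ∈ fullCoalition part ι κ T, f x =
      ∑ p ∈ T, (∑ u with part u = p, f (ι u) + f (κ p)) := by
  rw [h.sum_eq, h.vertices_fullCoalition, h.players_fullCoalition, sum_owned,
    Finset.sum_add_distrib]

/-! The value of a full coalition -/

/-- Without pendant edges `U` is empty, and capacity 1 makes `M` a matching. -/
theorem thin_value (h : IsPendantExtension False G w part W ι κ H w') {b : X → ℕ+}
    (hb : ∀ u, b (ι u) = 1) (S : Finset X) :
    maxBMatching H b w' S = maxMatching G w (vertices ι S) := by
  apply le_antisymm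
  · refine h.maxBMatching_le fun M U ha => ?_
    have hU : U = ∅ := Finset.eq_empty_of_forall_notMem ha.wide
    subst hU
    simp only [Finset.card_empty, Nat.cast_zero, zero_mul, add_zero]
    refine le_maxMatching (fun e he => ⟨ha.edge e he, fun u hu => mem_vertices.2
      (ha.mem e he u hu)⟩) (noCommonEnd_iff_card_le_one.2 fun u => ?_)
    simpa [hb] using ha.card_vertex u
  · refine maxMatching_le fun M h₁ h₂ => ?_
    have := h.le_maxBMatching (b := b) (S := S) (M := M) (U := ∅)
      ⟨fun e he => (h₁ e he).1, fun e he u hu => mem_vertices.1 ((h₁ e he).2 u hu), by simp,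
        by simp, by simp, fun u => by simpa [hb] using noCommonEnd_iff_card_le_one.1 h₂ u, by simp⟩
    simpa using this

variable (G w) in
/-- The total weight of the edges. -/
def totalWeight : ℝ := ∑ e with e ∈ G.edgeSet, w e

theorem sum_le_totalWeight (hw : ∀ e, 0 ≤ w e) {M : Finset (Sym2 V)}
    (hM : ∀ e ∈ M, e ∈ G.edgeSet) : ∑ e ∈ M, w e ≤ totalWeight G w :=
  Finset.sum_le_sum_of_subset_of_nonneg (fun e he => by simpa using hM e he) fun e _ _ => hw e

theorem maxMatching_le_totalWeight (hw : ∀ e, 0 ≤ w e) (S : Finset V) :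
    maxMatching G w S ≤ totalWeight G w :=
  maxMatching_le fun _ hM _ => sum_le_totalWeight hw fun e he => (hM e he).1

/-- A pendant edge lies inside `S` only if both its vertex and the owner of that vertex do. -/
theorem wide_value_le (h : IsPendantExtension True G w part W ι κ H w') {b : X → ℕ+}
    (hw : ∀ e, 0 ≤ w e) (hW : 0 ≤ W) (S : Finset X) :
    maxBMatching H b w' S ≤
      totalWeight G w + (vertices ι S ∩ owned part (players κ S)).card * W := by
  refine h.maxBMatching_le fun M U ha => add_le_add (sum_le_totalWeight hw ha.edge) ?_
  gcongr
  intro u hu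
  simp [mem_vertices, mem_owned, mem_players, ha.vertex_mem u hu, ha.player_mem u hu]

theorem wide_value (h : IsPendantExtension True G w part W ι κ H w') {b : X → ℕ+}
    (hb : ∀ u, b (ι u) = 2)
    (hb' : ∀ p, (b (κ p) : ℕ) = (Finset.univ.filter fun u => part u = p).card)
    (hw : ∀ e, 0 ≤ w e) (hW : totalWeight G w ≤ W) (T : Finset N) :
    maxBMatching H b w' (fullCoalition part ι κ T) =
      (owned part T).card * W + maxMatching G w (owned part T) := by
  have hv := h.vertices_fullCoalition T
  have hp := h.players_fullCoalition T
  have hW0 : 0 ≤ W := (Finset.sum_nonneg fun e _ => hw e).trans hW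
  apply le_antisymm
  · refine h.maxBMatching_le fun M U ha => ?_
    have hU : U ⊆ owned part T := fun u hu => by
      rw [← hv]
      exact mem_vertices.2 (ha.vertex_mem u hu)
    -- If all pendant edges are used, each vertex has one unit of capacity left and `M` is a
    -- matching. If one is missing, the loss of `W` outweighs all of `M`.
    rcases hU.eq_or_ssubset with rfl | hU
    · rw [add_comm]
      refine add_le_add le_rfl (le_maxMatching (fun e he => ⟨ha.edge e he, fun u hu => ?_⟩)
        (noCommonEnd_iff_card_le_one.2 fun u => ?_))
      · rw [← hv]
        exact mem_vertices.2 (ha.mem e he u hu)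
      · by_cases hu : u ∈ owned part T
        · simpa [hb, hu] using ha.card_vertex u
        · have : (M.filter fun e => u ∈ e) = ∅ := Finset.filter_eq_empty_iff.2 fun e he hue =>
            hu (by rw [← hv]; exact mem_vertices.2 (ha.mem e he u hue))
          simp [this]
    · have h₁ := sum_le_totalWeight hw ha.edge
      have h₂ : ((U.card : ℝ) + 1) * W ≤ (owned part T).card * W := by
        gcongr
        exact_mod_cast Finset.card_lt_card hU
      have h₃ := maxMatching_nonneg G w (owned part T)
      linarith
  · rw [add_comm, ← le_sub_iff_add_le]
    refine maxMatching_le fun M h₁ h₂ => ?_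
    rw [le_sub_iff_add_le]
    refine h.le_maxBMatching ⟨fun e he => (h₁ e he).1, fun e he u hu => ?_, fun _ _ => trivial,
      fun u hu => ?_, fun u hu => ?_, fun u => ?_, fun p => ?_⟩
    · rw [← mem_vertices, hv]
      exact (h₁ e he).2 u hu
    · rwa [← mem_vertices, hv]
    · rwa [← mem_players, hp, ← mem_owned]
    · have := noCommonEnd_iff_card_le_one.1 h₂ u
      rw [hb]
      split_ifs <;> simp <;> lia
    · rw [hb']
      exact Finset.card_le_card (Finset.filter_subset_filter _ (Finset.subset_univ _))

/-! Allocations -/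

/-- No part is empty, so a set of players can be recovered from its vertices. -/
theorem image_part_owned (hs : Function.Surjective part) (T : Finset N) :
    (owned part T).image part = T := by
  ext p
  obtain ⟨u, rfl⟩ := hs p
  simp only [Finset.mem_image, mem_owned]
  exact ⟨fun ⟨v, hv, he⟩ => he ▸ hv, fun h => ⟨u, h, rfl⟩⟩

theorem wide_sum (h : IsPendantExtension True G w part W ι κ H w') {K : ℝ} {x : N → ℝ}
    {y : X → ℝ} (hy : ∀ u, y (ι u) = K)
    (hy' : ∀ p, y (κ p) = K * (Finset.univ.filter fun u => part u = p).card + x p)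
    (S : Finset X) : ∑ a ∈ S, y a = K * ((vertices ι S).card + (owned part (players κ S)).card) +
      ∑ p ∈ players κ S, x p := by
  rw [h.sum_eq, Finset.sum_congr rfl fun u _ => hy u, Finset.sum_congr rfl fun p _ => hy' p,
    Finset.sum_add_distrib, ← Finset.mul_sum, ← card_owned]
  simp
  ring

/-- The excess of every full coalition is the same as in the original game. -/
theorem wide_excess (h : IsPendantExtension True G w part W ι κ H w') {b : X → ℕ+}
    (hb : ∀ u, b (ι u) = 2)
    (hb' : ∀ p, (b (κ p) : ℕ) = (Finset.univ.filter fun u => part u = p).card)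
    (hw : ∀ e, 0 ≤ w e) {K : ℝ} {x : N → ℝ} {y : X → ℝ} (hK : totalWeight G w ≤ W)
    (hWK : W = 2 * K) (hy : ∀ u, y (ι u) = K)
    (hy' : ∀ p, y (κ p) = K * (Finset.univ.filter fun u => part u = p).card + x p)
    (T : Finset N) :
    ∑ a ∈ fullCoalition part ι κ T, y a - maxBMatching H b w' (fullCoalition part ι κ T) =
      ∑ p ∈ T, x p - maxMatching G w (owned part T) := by
  rw [h.wide_sum hy hy', h.wide_value hb hb' hw hK, h.vertices_fullCoalition,
    h.players_fullCoalition, hWK]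
  ring

/-- Violated coalitions are translated back. -/
theorem wide_violated (h : IsPendantExtension True G w part W ι κ H w')
    (hs : Function.Surjective part) {b : X → ℕ+} (hb : ∀ u, b (ι u) = 2)
    (hb' : ∀ p, (b (κ p) : ℕ) = (Finset.univ.filter fun u => part u = p).card)
    (hw : ∀ e, 0 ≤ w e) {K : ℝ} {x : N → ℝ} {y : X → ℝ}
    (hK : totalWeight G w + ∑ p, |x p| ≤ K) (hWK : W = 2 * K) (hy : ∀ u, y (ι u) = K)
    (hy' : ∀ p, y (κ p) = K * (Finset.univ.filter fun u => part u = p).card + x p)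
    {S : Finset X} (hS : ∑ a ∈ S, y a < maxBMatching H b w' S) :
    ∑ p ∈ (vertices ι S).image part, x p <
      maxMatching G w (owned part ((vertices ι S).image part)) := by
  have h0 : 0 ≤ totalWeight G w := Finset.sum_nonneg fun e _ => hw e
  have hx : ∑ p ∈ players κ S, |x p| ≤ ∑ p, |x p| :=
    Finset.sum_le_sum_of_subset_of_nonneg (Finset.subset_univ _) fun p _ _ => abs_nonneg _
  have hx' := (Finset.abs_sum_le_sum_abs x (players κ S)).trans hx
  have hx0 : 0 ≤ ∑ p, |x p| := Finset.sum_nonneg fun p _ => abs_nonneg _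
  have hKW : totalWeight G w ≤ W := by linarith
  -- Equality means that `S` is full, in which case excesses agree; otherwise `S` cannot be
  -- violated.
  by_cases hAB : vertices ι S = owned part (players κ S)
  · have hST : S = fullCoalition part ι κ (players κ S) := by
      conv_lhs => rw [h.eq_union S, hAB]
      rfl
    have h₁ := h.wide_excess hb hb' hw hKW hWK hy hy' (players κ S)
    rw [← hST] at h₁
    rw [hAB, image_part_owned hs]
    linarith
  · exfalso
    have h₁ := h.wide_value_le (b := b) hw (by linarith) S
    rw [h.wide_sum hy hy'] at hS
    -- Two different finite sets have a union larger than their intersection. The additional 1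
    -- yields a spare `K`, which absorbs the total weight and `∑ |x p|`.
    have h₂ : 2 * (vertices ι S ∩ owned part (players κ S)).card + 1 ≤
        (vertices ι S).card + (owned part (players κ S)).card := by
      have h₃ := Finset.card_union_add_card_inter (vertices ι S) (owned part (players κ S))
      have h₄ : (vertices ι S ∩ owned part (players κ S)).card <
          (vertices ι S ∪ owned part (players κ S)).card := by
        refine Finset.card_lt_card ((Finset.inter_subset_union).ssubset_of_ne fun he => hAB ?_)
        exact le_antisymm (fun u hu => (Finset.mem_inter.1 (he ▸ Finset.mem_union_left _ hu)).2)
          fun u hu => (Finset.mem_inter.1 (he ▸ Finset.mem_union_right _ hu)).1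
      lia
    have h₅ : K * (2 * (vertices ι S ∩ owned part (players κ S)).card + 1) ≤
        K * ((vertices ι S).card + (owned part (players κ S)).card) :=
      mul_le_mul_of_nonneg_left (by exact_mod_cast h₂) (by linarith)
    have h₆ := neg_le_of_abs_le hx'
    rw [hWK] at h₁
    nlinarith

theorem thin_sum (h : IsPendantExtension False G w part W ι κ H w')
    (hs : Function.Bijective part) {x : N → ℝ} {y : X → ℝ} (hy : ∀ u, y (ι u) = x (part u))
    (hy' : ∀ p, y (κ p) = 0) (S : Finset X) :
    ∑ a ∈ S, y a = ∑ p ∈ (vertices ι S).image part, x p := by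
  rw [h.sum_eq, Finset.sum_image hs.1.injOn, Finset.sum_congr rfl fun u _ => hy u,
    Finset.sum_congr rfl fun p _ => hy' p]
  simp

/-- The players are isolated and receive nothing, so the excess of `S` depends only on its vertices,
which correspond bijectively to the original players. -/
theorem thin_excess (h : IsPendantExtension False G w part W ι κ H w')
    (hs : Function.Bijective part) {b : X → ℕ+} (hb : ∀ u, b (ι u) = 1) {x : N → ℝ} {y : X → ℝ}
    (hy : ∀ u, y (ι u) = x (part u)) (hy' : ∀ p, y (κ p) = 0) (S : Finset X) :
    ∑ a ∈ S, y a - maxBMatching H b w' S = ∑ p ∈ (vertices ι S).image part, x p -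
      maxMatching G w (owned part ((vertices ι S).image part)) := by
  rw [h.thin_sum hs hy hy', h.thin_value hb]
  congr 2
  ext u
  simp [mem_owned, hs.1.eq_iff]

end IsPendantExtension

end PendantExtension

end

noncomputable section

/-! ### The `b`-matching game of a partitioned matching game -/

/-- Each entry of `L` is counted for at most one element of `A`. -/
theorem List.sum_sum_filter_le {ι κ : Type*} [DecidableEq κ] (L : List ι) (g : ι → κ) (f : ι → ℝ)
    (hf : ∀ a, 0 ≤ f a) (A : Finset κ) :
    ∑ e ∈ A, ((L.filter fun a => g a = e).map f).sum ≤ (L.map f).sum := by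
  induction L with
  | nil => simp
  | cons a L ih =>
    have h : ∀ e, (((a :: L).filter fun a => g a = e).map f).sum =
        (if g a = e then f a else 0) + ((L.filter fun a => g a = e).map f).sum := by
      intro e
      by_cases h : g a = e <;> simp [h]
    simp only [h, Finset.sum_add_distrib, Finset.sum_ite_eq, List.map_cons, List.sum_cons]
    refine add_le_add ?_ ih
    split_ifs
    exacts [le_rfl, hf a]

theorem posFracVal_nonneg (q : ℕ+ × ℕ+) : 0 ≤ posFracVal q := by
  unfold posFracVal
  positivity

theorem posFracVal_le (q : ℕ+ × ℕ+) : posFracVal q ≤ (q.1 : ℕ) :=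
  div_le_self (by positivity) (by exact_mod_cast q.2.2)

theorem abs_fracVal_le (q : ℤ × ℕ+) : |fracVal q| ≤ (q.1.natAbs : ℝ) := by
  rw [fracVal, abs_div, Nat.abs_cast, Nat.cast_natAbs, Int.cast_abs]
  exact div_le_self (abs_nonneg _) (by exact_mod_cast q.2.2)

theorem WGraph.weight_nonneg {n : ℕ} (H : WGraph n) (e : Sym2 (Fin n)) : 0 ≤ H.weight e := by
  refine List.sum_nonneg fun r hr => ?_
  obtain ⟨f, -, rfl⟩ := List.mem_map.1 hr
  exact posFracVal_nonneg _

theorem WGraph.mem_edgeSet {n : ℕ} (H : WGraph n) (e : Sym2 (Fin n)) :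
    e ∈ H.graph.edgeSet ↔ ∃ f ∈ H.edges, s(f.1.1, f.1.2) = e := by
  simp only [WGraph.graph, SimpleGraph.edgeSet_fromEdgeSet, Set.mem_sdiff, Set.mem_ofPred_eq,
    List.mem_map]
  refine ⟨fun h => h.1, fun h => ⟨h, ?_⟩⟩
  obtain ⟨f, hf, rfl⟩ := h
  simpa using H.ne f hf

namespace PMInstance

variable (I : PMInstance)

/-- The number of vertices of the player `p`. -/
def partSize (p : Fin I.k) : ℕ := (Finset.univ.filter fun u => I.part u = p).card

theorem partSize_pos (p : Fin I.k) : 0 < I.partSize p := by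
  obtain ⟨u, rfl⟩ := I.part_surj p
  exact Finset.card_pos.2 ⟨u, by simp⟩

theorem k_le_n : I.k ≤ I.n := by
  simpa using Fintype.card_le_of_surjective _ I.part_surj

/-- The edges between the vertices and their players, unless every part is a singleton. -/
def pendantEdges (K : ℕ+) : List ((Fin (I.n + I.k) × Fin (I.n + I.k)) × (ℕ+ × ℕ+)) :=
  if I.k = I.n then [] else
    List.ofFn fun u => ((u.castAdd I.k, (I.part u).natAdd I.n), (2 * K, 1))

/-- The copies of the edges of the graph. -/
def copiedEdges : List ((Fin (I.n + I.k) × Fin (I.n + I.k)) × (ℕ+ × ℕ+)) :=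
  I.graph.edges.map fun e => ((e.1.1.castAdd I.k, e.1.2.castAdd I.k), e.2)

theorem mem_pendantEdges {K : ℕ+} {e} : e ∈ I.pendantEdges K ↔
    I.k ≠ I.n ∧ ∃ u, ((u.castAdd I.k, (I.part u).natAdd I.n), (2 * K, 1)) = e := by
  unfold pendantEdges
  split_ifs with h <;> simp [h, List.mem_ofFn]

/-- The embedding of the vertices. -/
abbrev vertexEmb : Fin I.n ↪ Fin (I.n + I.k) := Fin.castAddEmb I.k

/-- The embedding of the players. -/
abbrev playerEmb : Fin I.k ↪ Fin (I.n + I.k) := Fin.natAddEmb I.n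

theorem vertex_ne_player (u : Fin I.n) (p : Fin I.k) : u.castAdd I.k ≠ p.natAdd I.n := by
  intro h
  have := congrArg Fin.val h
  simp at this
  lia

theorem map_ne_pendantEdge (e : Sym2 (Fin I.n)) (u : Fin I.n) :
    e.map I.vertexEmb ≠ pendantEdge I.part I.vertexEmb I.playerEmb u := by
  intro h
  have : I.playerEmb (I.part u) ∈ e.map I.vertexEmb := h ▸ Sym2.mem_mk_right _ _
  obtain ⟨v, -, hv⟩ := Sym2.mem_map.1 this
  exact I.vertex_ne_player _ _ hv

theorem pendantEdge_injective :
    Function.Injective (pendantEdge I.part I.vertexEmb I.playerEmb) := by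
  intro u v h
  have h : I.vertexEmb u ∈ pendantEdge I.part I.vertexEmb I.playerEmb v :=
    h ▸ Sym2.mem_mk_left _ _
  rcases Sym2.mem_iff.1 h with h | h
  · exact I.vertexEmb.injective h
  · exact absurd h (I.vertex_ne_player _ _)

/-- The graph of the `b`-matching game. -/
def extendedGraph (K : ℕ+) : WGraph (I.n + I.k) where
  edges := I.copiedEdges ++ I.pendantEdges K
  ne e he := by
    rcases List.mem_append.1 he with he | he
    · obtain ⟨f, hf, rfl⟩ := List.mem_map.1 he
      simpa using I.graph.ne f hf
    · obtain ⟨-, u, rfl⟩ := I.mem_pendantEdges.1 he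
      exact I.vertex_ne_player _ _
  nodup := by
    rw [List.map_append, List.nodup_append']
    refine ⟨?_, ?_, ?_⟩
    · have := I.graph.nodup.map (Sym2.map.injective I.vertexEmb.injective)
      rw [List.map_map] at this
      rw [copiedEdges, List.map_map]
      exact this
    · unfold pendantEdges
      split_ifs
      · simp
      · rw [List.map_ofFn, List.nodup_ofFn]
        exact I.pendantEdge_injective
    · rw [List.disjoint_left]
      intro e he he'
      obtain ⟨f, hf, rfl⟩ := List.mem_map.1 he
      obtain ⟨g, hg, hfg⟩ := List.mem_map.1 he'
      obtain ⟨f, -, rfl⟩ := List.mem_map.1 hf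
      obtain ⟨-, u, rfl⟩ := I.mem_pendantEdges.1 hg
      exact I.map_ne_pendantEdge s(f.1.1, f.1.2) u hfg.symm

/-- The capacity of a player. -/
def partCap (p : Fin I.k) : ℕ+ := ⟨I.partSize p, I.partSize_pos p⟩

/-- The capacities of the `b`-matching game. -/
def extendedCap : Fin (I.n + I.k) → ℕ+ :=
  Fin.append (fun _ => if I.k = I.n then 1 else 2) I.partCap

/-- The `b`-matching game that models the partitioned matching game; the number `K` has to be
large. -/
def toBM (K : ℕ+) : BMInstance := ⟨I.n + I.k, I.extendedGraph K, I.extendedCap⟩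

/-- The game described by `toBM`. -/
def extendedGame (K : ℕ+) : CoopGame (Fin (I.n + I.k)) :=
  bMatchingGame (I.extendedGraph K).graph I.extendedCap (I.extendedGraph K).weight

theorem cap_vertex (u : Fin I.n) :
    I.extendedCap (I.vertexEmb u) = if I.k = I.n then 1 else 2 :=
  Fin.append_left _ _ u

theorem cap_player (p : Fin I.k) : (I.extendedCap (I.playerEmb p) : ℕ) = I.partSize p :=
  congrArg PNat.val (Fin.append_right _ _ p)

theorem extendedGraph_mem_edgeSet (K : ℕ+) (e : Sym2 (Fin (I.n + I.k))) :
    e ∈ (I.extendedGraph K).graph.edgeSet ↔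
      (∃ f ∈ I.graph.graph.edgeSet, f.map I.vertexEmb = e) ∨
        I.k ≠ I.n ∧ ∃ u, pendantEdge I.part I.vertexEmb I.playerEmb u = e := by
  rw [WGraph.mem_edgeSet]
  constructor
  · rintro ⟨f, hf, rfl⟩
    rcases List.mem_append.1 hf with hf | hf
    · obtain ⟨g, hg, rfl⟩ := List.mem_map.1 hf
      exact .inl ⟨s(g.1.1, g.1.2), (WGraph.mem_edgeSet _ _).2 ⟨g, hg, rfl⟩, rfl⟩
    · obtain ⟨h, u, rfl⟩ := I.mem_pendantEdges.1 hf
      exact .inr ⟨h, u, rfl⟩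
  · rintro (⟨e, he, rfl⟩ | ⟨h, u, rfl⟩)
    · obtain ⟨f, hf, rfl⟩ := (WGraph.mem_edgeSet _ _).1 he
      exact ⟨_, List.mem_append_left _ (List.mem_map_of_mem hf), rfl⟩
    · exact ⟨_, List.mem_append_right _ (I.mem_pendantEdges.2 ⟨h, u, rfl⟩), rfl⟩

theorem weight_map (K : ℕ+) (e : Sym2 (Fin I.n)) :
    (I.extendedGraph K).weight (e.map I.vertexEmb) = I.graph.weight e := by
  have h₁ : (I.pendantEdges K).filter (fun f => s(f.1.1, f.1.2) = e.map I.vertexEmb) = [] := by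
    refine List.filter_eq_nil_iff.2 fun f hf => ?_
    obtain ⟨-, u, rfl⟩ := I.mem_pendantEdges.1 hf
    exact decide_eq_false (I.map_ne_pendantEdge e u).symm ▸ Bool.false_ne_true
  have h₂ : ∀ f : (Fin I.n × Fin I.n) × (ℕ+ × ℕ+),
      s(f.1.1.castAdd I.k, f.1.2.castAdd I.k) = e.map I.vertexEmb ↔ s(f.1.1, f.1.2) = e :=
    fun f => (Sym2.map.injective I.vertexEmb.injective).eq_iff (a := s(f.1.1, f.1.2))
  simp only [WGraph.weight, extendedGraph, List.filter_append, h₁, List.append_nil, copiedEdges,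
    List.filter_map, List.map_map, Function.comp_def, h₂]

theorem weight_pendantEdge (K : ℕ+) (h : I.k ≠ I.n) (u : Fin I.n) :
    (I.extendedGraph K).weight (pendantEdge I.part I.vertexEmb I.playerEmb u) = 2 * (K : ℕ) := by
  have h₁ : I.copiedEdges.filter
      (fun f => s(f.1.1, f.1.2) = pendantEdge I.part I.vertexEmb I.playerEmb u) = [] := by
    refine List.filter_eq_nil_iff.2 fun f hf => ?_
    obtain ⟨f, -, rfl⟩ := List.mem_map.1 hf
    simpa using I.map_ne_pendantEdge s(f.1.1, f.1.2) u
  have h₂ : ∀ v : Fin I.n, s(v.castAdd I.k, (I.part v).natAdd I.n) =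
      pendantEdge I.part I.vertexEmb I.playerEmb u ↔ v = u :=
    fun v => I.pendantEdge_injective.eq_iff (a := v)
  have h₃ : (List.finRange I.n).filter (fun v => v = u) = [u] := by
    rw [List.filter_eq, List.count_eq_one_of_mem (List.nodup_finRange _) (List.mem_finRange u)]
    rfl
  simp only [WGraph.weight, extendedGraph, List.filter_append, h₁, List.nil_append, pendantEdges,
    if_neg h, List.ofFn_eq_map, List.filter_map, List.map_map, Function.comp_def, h₂, h₃]
  simp [posFracVal]

theorem isPendantExtension (K : ℕ+) :
    IsPendantExtension (I.k ≠ I.n) I.graph.graph I.graph.weight I.part (2 * (K : ℕ))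
      I.vertexEmb I.playerEmb (I.extendedGraph K).graph (I.extendedGraph K).weight where
  ne := I.vertex_ne_player
  cover x := by
    induction x using Fin.addCases with
    | left u => exact .inl ⟨u, rfl⟩
    | right p => exact .inr ⟨p, rfl⟩
  mem_edgeSet := I.extendedGraph_mem_edgeSet K
  weight_map e _ := I.weight_map K e
  weight_pendant := I.weight_pendantEdge K

theorem isPendantExtension_thin (K : ℕ+) (h : I.k = I.n) :
    IsPendantExtension False I.graph.graph I.graph.weight I.part (2 * (K : ℕ))
      I.vertexEmb I.playerEmb (I.extendedGraph K).graph (I.extendedGraph K).weight := by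
  simpa [h] using I.isPendantExtension K

theorem isPendantExtension_wide (K : ℕ+) (h : I.k ≠ I.n) :
    IsPendantExtension True I.graph.graph I.graph.weight I.part (2 * (K : ℕ))
      I.vertexEmb I.playerEmb (I.extendedGraph K).graph (I.extendedGraph K).weight := by
  simpa [h] using I.isPendantExtension K

theorem part_bijective (h : I.k = I.n) : Function.Bijective I.part :=
  (Fintype.bijective_iff_surjective_and_card _).2 ⟨I.part_surj, by simp [h]⟩

theorem partSize_le_width (p : Fin I.k) : I.partSize p ≤ I.width := by
  unfold width partitionWidth partSize
  refine le_trans (le_of_eq ?_) (Finset.le_sup (Finset.mem_univ p))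
  congr

/-- Capacity 2 occurs only when `I.k ≠ I.n`; then `I.part` is not injective, and some part has two
vertices. This is why the case of singleton parts is treated separately. -/
theorem bstar_toBM_le (K : ℕ+) : (I.toBM K).bstar ≤ I.width := by
  change Finset.univ.sup (fun x => (I.extendedCap x : ℕ)) ≤ _
  refine Finset.sup_le fun x _ => ?_
  obtain ⟨u, rfl⟩ | ⟨p, rfl⟩ := (I.isPendantExtension K).cover x
  · rw [cap_vertex]
    split_ifs with h
    · exact (I.partSize_pos (I.part u)).trans_le (I.partSize_le_width _)
    · have : ¬ Function.Injective I.part := fun hi =>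
        h (I.k_le_n.antisymm (by simpa using Fintype.card_le_of_injective _ hi))
      simp only [Function.Injective, not_forall] at this
      obtain ⟨v, v', hv, hne⟩ := this
      refine le_trans ?_ (I.partSize_le_width (I.part v))
      exact Finset.one_lt_card.2 ⟨v, by simp, v', by simp [hv], hne⟩
  · rw [cap_player]
    exact I.partSize_le_width p

/-- The sum of the numerators of the weights. -/
def weightBound : ℕ := (I.graph.edges.map fun e => (e.2.1 : ℕ)).sum

/-! ### Comparison of the two games -/

open IsPendantExtension

/-- Denominators are at least 1. Summing only numerators yields an integer bound without any
arithmetic of fractions. -/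
theorem totalWeight_le : totalWeight I.graph.graph I.graph.weight ≤ I.weightBound := by
  refine (List.sum_sum_filter_le I.graph.edges (fun f => s(f.1.1, f.1.2))
    (fun f => posFracVal f.2) (fun e => posFracVal_nonneg e.2) _).trans ?_
  rw [weightBound]
  induction I.graph.edges with
  | nil => simp
  | cons e l ih =>
    simp only [List.map_cons, List.sum_cons, Nat.cast_add]
    exact add_le_add (posFracVal_le _) ih

/-- The translation of allocations. -/
def liftAlloc (K : ℕ+) (x : Fin I.k → ℝ) : Fin (I.n + I.k) → ℝ :=
  Fin.append (fun u => if I.k = I.n then x (I.part u) else (K : ℕ))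
    fun p => if I.k = I.n then 0 else (K : ℕ) * I.partSize p + x p

theorem liftAlloc_vertex (K : ℕ+) (x : Fin I.k → ℝ) (u : Fin I.n) :
    I.liftAlloc K x (I.vertexEmb u) = if I.k = I.n then x (I.part u) else (K : ℕ) :=
  Fin.append_left _ _ u

theorem liftAlloc_player (K : ℕ+) (x : Fin I.k → ℝ) (p : Fin I.k) :
    I.liftAlloc K x (I.playerEmb p) = if I.k = I.n then 0 else (K : ℕ) * I.partSize p + x p :=
  Fin.append_right _ _ p

theorem game_v (T : Finset (Fin I.k)) :
    I.game.v T = maxMatching I.graph.graph I.graph.weight (owned I.part T) := rfl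

/-- Identifies the count for any decision procedure, in particular the classical one, with
`partSize`. -/
theorem card_filter_part (p : Fin I.k) (inst : DecidablePred fun u => I.part u = p) :
    (@Finset.filter _ (fun u => I.part u = p) inst Finset.univ).card = I.partSize p := by
  unfold partSize
  congr

/-- In the wide case the payment of `K` to each end of a pendant edge cancels its weight `2K`; in
the thin case there is nothing to cancel. -/
theorem excess_fullCoalition {K : ℕ+} (hK : I.weightBound ≤ (K : ℕ)) (x : Fin I.k → ℝ)
    (T : Finset (Fin I.k)) :
    ∑ a ∈ fullCoalition I.part I.vertexEmb I.playerEmb T, I.liftAlloc K x a -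
      (I.extendedGame K).v (fullCoalition I.part I.vertexEmb I.playerEmb T) =
    ∑ p ∈ T, x p - I.game.v T := by
  have hK' : (I.weightBound : ℝ) ≤ (K : ℕ) := by exact_mod_cast hK
  have hw := I.totalWeight_le
  by_cases h : I.k = I.n
  · have hE := I.isPendantExtension_thin K h
    have := hE.thin_excess (b := I.extendedCap) (I.part_bijective h)
      (fun u => by rw [cap_vertex, if_pos h])
      (x := x) (y := I.liftAlloc K x) (fun u => by rw [liftAlloc_vertex, if_pos h])
      (fun p => by rw [liftAlloc_player, if_pos h])
      (fullCoalition I.part I.vertexEmb I.playerEmb T)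
    rw [hE.vertices_fullCoalition, image_part_owned I.part_surj] at this
    exact this
  · refine (I.isPendantExtension_wide K h).wide_excess (b := I.extendedCap) (K := (K : ℕ))
      (fun u => by rw [cap_vertex, if_neg h]) (fun p => by rw [cap_player, card_filter_part])
      I.graph.weight_nonneg (by linarith) rfl (fun u => by rw [liftAlloc_vertex, if_neg h])
      (fun p => by rw [liftAlloc_player, if_neg h, card_filter_part]) T

/-- The owners of the vertices in `S` form the violated coalition in both cases. When pendant edges
are present, a violated `S` is full, and these owners are exactly its players. -/
theorem violated_of_violated {K : ℕ+} {x : Fin I.k → ℝ}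
    (hK : totalWeight I.graph.graph I.graph.weight + ∑ p, |x p| ≤ (K : ℕ))
    {S : Finset (Fin (I.n + I.k))}
    (hS : ∑ a ∈ S, I.liftAlloc K x a < (I.extendedGame K).v S) :
    ∑ p ∈ (vertices I.vertexEmb S).image I.part, x p <
      I.game.v ((vertices I.vertexEmb S).image I.part) := by
  by_cases h : I.k = I.n
  · have := (I.isPendantExtension_thin K h).thin_excess (b := I.extendedCap) (I.part_bijective h)
      (fun u => by rw [cap_vertex, if_pos h])
      (x := x) (y := I.liftAlloc K x) (fun u => by rw [liftAlloc_vertex, if_pos h])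
      (fun p => by rw [liftAlloc_player, if_pos h]) S
    rw [← sub_neg] at hS ⊢
    rw [game_v]
    refine lt_of_eq_of_lt ?_ (lt_of_eq_of_lt this.symm hS)
    congr!
  · have := (I.isPendantExtension_wide K h).wide_violated I.part_surj (b := I.extendedCap)
      (K := (K : ℕ)) (fun u => by rw [cap_vertex, if_neg h])
      (fun p => by rw [cap_player, card_filter_part])
      I.graph.weight_nonneg hK rfl (fun u => by rw [liftAlloc_vertex, if_neg h])
      (fun p => by rw [liftAlloc_player, if_neg h, card_filter_part]) hS
    rw [game_v]
    convert this

theorem isAllocation_liftAlloc_iff {K : ℕ+} (hK : I.weightBound ≤ (K : ℕ)) (x : Fin I.k → ℝ) :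
    (I.extendedGame K).IsAllocation (I.liftAlloc K x) ↔ I.game.IsAllocation x := by
  have h := I.excess_fullCoalition hK x Finset.univ
  rw [(I.isPendantExtension K).fullCoalition_univ] at h
  unfold CoopGame.IsAllocation
  rw [← sub_eq_zero, ← sub_eq_zero (a := ∑ p, x p), ← h]

/-- A core allocation is non-negative on singletons, so `∑ |x p| = v(N)` is at most the total
weight. Twice the weight bound therefore suffices for `K`, independently of `x`. -/
theorem liftAlloc_mem_core {K : ℕ+} (hK : 2 * I.weightBound ≤ (K : ℕ)) {x : Fin I.k → ℝ}
    (hx : x ∈ I.game.core) : I.liftAlloc K x ∈ (I.extendedGame K).core := by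
  have hw := I.totalWeight_le
  have hK' : (2 * I.weightBound : ℝ) ≤ (K : ℕ) := by exact_mod_cast hK
  refine ⟨(I.isAllocation_liftAlloc_iff (by lia) x).2 hx.1, fun S => ?_⟩
  by_contra hS
  have h₀ : ∀ p, 0 ≤ x p := fun p => by
    have := hx.2 {p}
    rw [Finset.sum_singleton] at this
    exact (maxMatching_nonneg _ _ _).trans this
  have h₁ : ∑ p, |x p| ≤ totalWeight I.graph.graph I.graph.weight := by
    rw [Finset.sum_congr rfl fun p _ => abs_of_nonneg (h₀ p), hx.1, game_v]
    exact maxMatching_le_totalWeight I.graph.weight_nonneg _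
  exact (hx.2 _).not_gt (I.violated_of_violated (by linarith) (not_le.1 hS))

/-- The translation of allocations back to the partitioned matching game. -/
def lowerAlloc (K : ℕ+) (y : Fin (I.n + I.k) → ℝ) (p : Fin I.k) : ℝ :=
  ∑ u with I.part u = p, y (I.vertexEmb u) + y (I.playerEmb p) -
    (if I.k = I.n then 0 else 2 * (K : ℕ) * I.partSize p : ℝ)

theorem value_fullCoalition {K : ℕ+} (hK : I.weightBound ≤ (K : ℕ)) (T : Finset (Fin I.k)) :
    (I.extendedGame K).v (fullCoalition I.part I.vertexEmb I.playerEmb T) =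
      I.game.v T + ∑ p ∈ T, if I.k = I.n then 0 else 2 * (K : ℕ) * (I.partSize p : ℝ) := by
  have hK' : (I.weightBound : ℝ) ≤ (K : ℕ) := by exact_mod_cast hK
  have hw := I.totalWeight_le
  by_cases h : I.k = I.n
  · have hE := I.isPendantExtension_thin K h
    have := hE.thin_value (b := I.extendedCap) (fun u => by rw [cap_vertex, if_pos h])
      (fullCoalition I.part I.vertexEmb I.playerEmb T)
    rw [hE.vertices_fullCoalition] at this
    simp only [if_pos h, Finset.sum_const_zero, add_zero]
    exact this
  · have := (I.isPendantExtension_wide K h).wide_value (b := I.extendedCap)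
      (fun u => by rw [cap_vertex, if_neg h]) (fun p => by rw [cap_player, card_filter_part])
      I.graph.weight_nonneg (by linarith) T
    refine this.trans ?_
    simp only [if_neg h, ← Finset.mul_sum, game_v, card_owned, card_filter_part]
    ring

/-- The core inequalities of full coalitions alone imply those of the original game; the subtracted
`2 * K * I.partSize p` accounts for the pendant edges. Here `K` need not dominate any allocation. -/
theorem lowerAlloc_mem_core {K : ℕ+} (hK : I.weightBound ≤ (K : ℕ)) {y : Fin (I.n + I.k) → ℝ}
    (hy : y ∈ (I.extendedGame K).core) : I.lowerAlloc K y ∈ I.game.core := by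
  have hE := I.isPendantExtension K
  have hsum : ∀ T, ∑ p ∈ T, I.lowerAlloc K y p - I.game.v T =
      ∑ a ∈ fullCoalition I.part I.vertexEmb I.playerEmb T, y a -
        (I.extendedGame K).v (fullCoalition I.part I.vertexEmb I.playerEmb T) := by
    intro T
    rw [I.value_fullCoalition hK, hE.sum_fullCoalition, ← sub_sub, sub_right_comm,
      ← Finset.sum_sub_distrib]
    congr 1
    refine Finset.sum_congr rfl fun p _ => ?_
    unfold lowerAlloc
    congr
  refine ⟨?_, fun T => ?_⟩
  · have h := hsum Finset.univ
    rw [hE.fullCoalition_univ] at h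
    have h' := hy.1
    unfold CoopGame.IsAllocation at *
    exact sub_eq_zero.1 (h.trans (sub_eq_zero.2 h'))
  · have h := hsum T
    have h' := hy.2 (fullCoalition I.part I.vertexEmb I.playerEmb T)
    linarith

end PMInstance

end

noncomputable section

/-! ### The reductions on encodings -/

section Encodings

/-- A fraction as a pair of integers. -/
def intFrac (q : ℤ × ℕ+) : ℤ × ℤ := (q.1, ((q.2 : ℕ) : ℤ))

/-- The sum of two fractions. -/
def fracAdd (a b : ℤ × ℕ+) : ℤ × ℕ+ := (a.1 * (b.2 : ℕ) + b.1 * (a.2 : ℕ), a.2 * b.2)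

/-- The sum of a list of fractions. -/
def fracSum (l : List (ℤ × ℕ+)) : ℤ × ℕ+ := l.foldl fracAdd (0, 1)

theorem fracVal_fracAdd (a b : ℤ × ℕ+) : fracVal (fracAdd a b) = fracVal a + fracVal b := by
  have h₁ : ((a.2 : ℕ) : ℝ) ≠ 0 := by exact_mod_cast a.2.ne_zero
  have h₂ : ((b.2 : ℕ) : ℝ) ≠ 0 := by exact_mod_cast b.2.ne_zero
  simp only [fracVal, fracAdd, PNat.mul_coe]
  push_cast
  field_simp

theorem fracVal_fracSum (l : List (ℤ × ℕ+)) : fracVal (fracSum l) = (l.map fracVal).sum := by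
  have key : ∀ a, fracVal (l.foldl fracAdd a) = fracVal a + (l.map fracVal).sum := by
    induction l with
    | nil => simp
    | cons b l ih => intro a; simp [ih, fracVal_fracAdd, add_assoc]
  simpa [fracVal, fracSum] using key (0, 1)

theorem intFracSum_map (l : List (ℤ × ℕ+)) :
    intFracSum (l.map intFrac) = intFrac (fracSum l) := by
  have key : ∀ a, (l.map intFrac).foldl intFracAdd (intFrac a) = intFrac (l.foldl fracAdd a) := by
    induction l with
    | nil => simp
    | cons b l ih =>
      intro a
      rw [List.map_cons, List.foldl_cons, List.foldl_cons, ← ih]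
      simp [intFrac, intFracAdd, fracAdd]
  exact key (0, 1)

theorem code_map {α β : Type} [Coded α] [Coded β] (h : α → β)
    (hh : ∀ a, Coded.code (h a) = Coded.code a) (l : List α) :
    Coded.code (l.map h) = Coded.code l := by
  induction l with
  | nil => rfl
  | cons a l ih => rw [List.map_cons, code_cons, code_cons, hh, ih]

theorem code_map_natCast (l : List ℕ) :
    Coded.code (l.map fun u : ℕ => (u : ℤ)) = Coded.code l :=
  code_map (fun u : ℕ => (u : ℤ)) (fun _ => rfl) l

theorem code_map_intFrac (l : List (ℤ × ℕ+)) : Coded.code (l.map intFrac) = Coded.code l :=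
  code_map intFrac (fun _ => rfl) l

theorem code_prod {α β γ δ : Type} [Coded α] [Coded β] [Coded γ] [Coded δ] {a : α} {b : β} {c : γ}
    {d : δ} (h₁ : Coded.code a = Coded.code c) (h₂ : Coded.code b = Coded.code d) :
    Coded.code (a, b) = Coded.code (c, d) := by
  rw [code_pair, code_pair, h₁, h₂]

theorem List.getInt_natCast {α : Type} (l : List α) (i : ℕ) (d : α) :
    l.getInt (i : ℤ) d = l.getD i d := by
  simp [List.getInt]

theorem List.getInt_map {α β : Type} (h : α → β) (l : List α) (i : ℤ) (d : α) :
    (l.map h).getInt i (h d) = h (l.getInt i d) := by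
  unfold List.getInt
  split_ifs
  · rw [List.getD_map]
  · rfl

theorem List.getD_ofFn {α : Type} {n : ℕ} (f : Fin n → α) (i : Fin n) (d : α) :
    (List.ofFn f).getD i d = f i := by
  simp

theorem List.map_range_eq_ofFn {α : Type} (n : ℕ) (f : ℕ → α) :
    (List.range n).map f = List.ofFn fun i : Fin n => f i := by
  apply List.ext_getElem <;> simp

/-- The encoding of a partitioned matching game, decoded as a list structure over the integers. -/
abbrev PMCode : Type := ℤ × List ℤ × List ((ℤ × ℤ) × (ℤ × ℤ))

namespace PMCode

/-- The number of vertices. -/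
def order (c : PMCode) : ℤ := c.2.1.length

/-- The list of the vertices. -/
def vertices (c : PMCode) : List ℤ := (List.range c.2.1.length).map fun i : ℕ => (i : ℤ)

/-- The list of the players. -/
def players (c : PMCode) : List ℤ :=
  c.vertices.filterMap fun p => if p + 1 ≤ c.1 then some p else none

/-- The number of vertices of a player. -/
def partSize (c : PMCode) (p : ℤ) : ℤ := (c.2.1.map fun q => if q = p then (1 : ℤ) else 0).sum

/-- The capacities of the `b`-matching game. -/
def caps (c : PMCode) : List ℤ :=
  (c.2.1.map fun _ => if c.1 = c.order then (1 : ℤ) else 2) ++ c.players.map c.partSize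

/-- The edges of the `b`-matching game. -/
def extendedEdges (c : PMCode) (K : ℤ) : List ((ℤ × ℤ) × (ℤ × ℤ)) :=
  c.2.2 ++ if c.1 = c.order then [] else
    c.vertices.map fun u => ((u, c.order + c.2.1.getInt u 0), (2 * K, 1))

/-- A sufficiently large number, where `m` bounds the sum of the absolute values of an
allocation. -/
def margin (c : PMCode) (m : ℤ) : ℤ := 1 + 2 * (c.2.2.map fun e => e.2.1).sum + m

/-- The translation of allocations. -/
def liftFrac (c : PMCode) (K : ℤ) (x : List (ℤ × ℤ)) : List (ℤ × ℤ) :=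
  (c.vertices.map fun u =>
    if c.1 = c.order then x.getInt (c.2.1.getInt u 0) (0, 1) else (K, 1)) ++
  c.players.map fun p => if c.1 = c.order then (0, 1) else
    (K * c.partSize p * (x.getInt p (0, 1)).2 + (x.getInt p (0, 1)).1, (x.getInt p (0, 1)).2)

/-- The translation of coalitions back to the partitioned matching game. -/
def lowerCoalition (c : PMCode) (L : List ℤ) : List ℤ :=
  L.filterMap fun u => if u + 1 ≤ c.order then some (c.2.1.getInt u 0) else none

/-- The translation of allocations back to the partitioned matching game. -/
def lowerFrac (c : PMCode) (K : ℤ) (y : List (ℤ × ℤ)) : List (ℤ × ℤ) :=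
  c.players.map fun p => intFracSum
    ((c.vertices.map fun u => if c.2.1.getInt u 0 = p then y.getInt u (0, 1) else (0, 1)) ++
      [y.getInt (c.order + p) (0, 1),
        (if c.1 = c.order then 0 else 0 - 2 * K * c.partSize p, 1)])

end PMCode

/-! ### The translations on integer lists run in polynomial time -/

namespace PolyTime

variable {α : Type} [Coded α] {c : α → PMCode} {K p : α → ℤ} {l : α → List (ℤ × ℤ)}

theorem order (hc : PolyTime c) : PolyTime fun a => (c a).order := hc.snd.fst.length

theorem vertices (hc : PolyTime c) : PolyTime fun a => (c a).vertices := hc.snd.fst.range_length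

theorem players (hc : PolyTime c) : PolyTime fun a => (c a).players :=
  filterMap_ite_le hc.vertices (id.snd.add (const 1)) (hc.comp id.fst).fst id.snd

theorem partSize (hc : PolyTime c) (hp : PolyTime p) :
    PolyTime fun a => (c a).partSize (p a) :=
  (map hc.snd.fst (ite_eq id.snd (hp.comp id.fst) (const 1) (const 0))).sum

theorem caps (hc : PolyTime c) : PolyTime fun a => (c a).caps :=
  (map hc.snd.fst (ite_eq hc.fst hc.order (const 1) (const 2) |>.comp id.fst)).append
    (map hc.players (partSize (hc.comp id.fst) id.snd))

theorem extendedEdges (hc : PolyTime c) (hK : PolyTime K) :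
    PolyTime fun a => (c a).extendedEdges (K a) :=
  hc.snd.snd.append (ite_eq hc.fst hc.order (const [])
    (map hc.vertices (pair (pair id.snd
      ((hc.order.comp id.fst).add (getInt (hc.snd.fst.comp id.fst) id.snd 0)))
      (pair ((const 2).mul (hK.comp id.fst)) (const 1)))))

theorem margin (hc : PolyTime c) (hK : PolyTime K) : PolyTime fun a => (c a).margin (K a) :=
  ((const 1).add ((const 2).mul (map hc.snd.snd id.snd.snd.fst).sum)).add hK

theorem liftFrac (hc : PolyTime c) (hK : PolyTime K) (hl : PolyTime l) :
    PolyTime fun a => (c a).liftFrac (K a) (l a) := by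
  have hx : PolyTime fun s : α × ℤ => (l s.1).getInt s.2 (0, 1) :=
    getInt (hl.comp id.fst) id.snd _
  exact (map hc.vertices (ite_eq (hc.fst.comp id.fst) (hc.order.comp id.fst)
      (getInt (hl.comp id.fst) (getInt (hc.snd.fst.comp id.fst) id.snd 0) _)
      (pair (hK.comp id.fst) (const 1)))).append
    (map hc.players (ite_eq (hc.fst.comp id.fst) (hc.order.comp id.fst) (const _)
      (pair ((((hK.comp id.fst).mul (partSize (hc.comp id.fst) id.snd)).mul hx.snd).add hx.fst)
        hx.snd)))

theorem lowerCoalition {l : α → List ℤ} (hc : PolyTime c) (hl : PolyTime l) :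
    PolyTime fun a => (c a).lowerCoalition (l a) :=
  filterMap_ite_le hl (id.snd.add (const 1)) (hc.order.comp id.fst)
    (getInt (hc.snd.fst.comp id.fst) id.snd 0)

theorem lowerFrac (hc : PolyTime c) (hK : PolyTime K) (hl : PolyTime l) :
    PolyTime fun a => (c a).lowerFrac (K a) (l a) :=
  map hc.players (fracSum ((map (hc.vertices.comp id.fst)
    (ite_eq (getInt (hc.snd.fst.comp id.fst.fst) id.snd 0) id.fst.snd
      (getInt (hl.comp id.fst.fst) id.snd _) (const _))).append
    (cons (getInt (hl.comp id.fst) ((hc.order.comp id.fst).add id.snd) _)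
      (cons (pair (ite_eq (hc.fst.comp id.fst) (hc.order.comp id.fst) (const 0)
        ((const 0).sub (((const 2).mul (hK.comp id.fst)).mul (partSize (hc.comp id.fst) id.snd))))
        (const 1)) (const [])))))

end PolyTime

/-! ### Agreement of the integer-list translations with the instances -/

namespace PMInstance

variable (I : PMInstance)

/-- An edge with its weight, over the integers. -/
def intEdge {n : ℕ} (e : (Fin n × Fin n) × (ℕ+ × ℕ+)) : (ℤ × ℤ) × (ℤ × ℤ) :=
  ((((e.1.1 : ℕ) : ℤ), ((e.1.2 : ℕ) : ℤ)), (((e.2.1 : ℕ) : ℤ), ((e.2.2 : ℕ) : ℤ)))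

theorem code_map_intEdge {n : ℕ} (l : List ((Fin n × Fin n) × (ℕ+ × ℕ+))) :
    Coded.code (l.map intEdge) = Coded.code l :=
  code_map intEdge (fun _ => rfl) l

/-- The encoding of the instance. -/
def toCode : PMCode :=
  ((I.k : ℤ), (List.ofFn fun u => ((I.part u : ℕ) : ℤ)), I.graph.edges.map intEdge)

theorem code_toCode : Coded.code I.toCode = Coded.code I := by
  refine code_prod rfl (code_prod ?_ (code_map_intEdge I.graph.edges))
  rw [← code_map (fun p : Fin I.k => ((p : ℕ) : ℤ)) (fun _ => rfl), List.map_ofFn]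
  rfl

theorem order_toCode : I.toCode.order = I.n := by simp [PMCode.order, toCode]

theorem thin_toCode_iff : I.toCode.1 = I.n ↔ I.k = I.n := Nat.cast_inj

theorem vertices_toCode : I.toCode.vertices = List.ofFn fun u : Fin I.n => ((u : ℕ) : ℤ) := by
  rw [← List.map_range_eq_ofFn I.n fun i : ℕ => (i : ℤ)]
  simp only [PMCode.vertices, toCode, List.length_ofFn]

/-- Listing the numbers below a binary `k` is not possible in polynomial time in general.
Surjectivity of `part` gives `k ≤ n`, so the players are found among the vertex numbers. -/
theorem players_toCode : I.toCode.players = List.ofFn fun p : Fin I.k => ((p : ℕ) : ℤ) := by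
  obtain ⟨m, hm⟩ := Nat.exists_eq_add_of_le I.k_le_n
  have h₁ : (List.range I.k).filterMap (fun p : ℕ => if (p : ℤ) + 1 ≤ I.k then some (p : ℤ)
      else none) = (List.range I.k).map fun i : ℕ => (i : ℤ) := by
    rw [← List.filterMap_eq_map]
    refine List.filterMap_congr fun p hp => if_pos ?_
    have := List.mem_range.1 hp
    lia
  have h₂ : (List.range m).filterMap (fun p : ℕ => if ((I.k + p : ℕ) : ℤ) + 1 ≤ I.k then
      some ((I.k + p : ℕ) : ℤ) else none) = [] :=
    List.filterMap_eq_nil_iff.2 fun p _ => if_neg (by lia)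
  rw [PMCode.players, vertices_toCode, ← List.map_range_eq_ofFn I.n fun i : ℕ => (i : ℤ),
    ← List.map_range_eq_ofFn I.k fun i : ℕ => (i : ℤ), hm, List.range_add, List.map_append,
    List.filterMap_append, List.filterMap_map, List.map_map, List.filterMap_map, ← h₁]
  exact (congrArg _ h₂).trans (List.append_nil _)

theorem partSize_toCode (p : Fin I.k) : I.toCode.partSize ((p : ℕ) : ℤ) = I.partSize p := by
  simp only [PMCode.partSize, toCode, List.map_ofFn, List.sum_ofFn, Function.comp_apply,
    Nat.cast_inj, Fin.val_inj, partSize, Finset.card_filter]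
  push_cast
  rfl

theorem part_toCode (u : Fin I.n) : I.toCode.2.1.getInt ((u : ℕ) : ℤ) 0 = ((I.part u : ℕ) : ℤ) := by
  rw [List.getInt_natCast]
  exact List.getD_ofFn _ u 0

theorem caps_toCode : I.toCode.caps =
    (List.ofFn I.extendedCap).map fun a : ℕ+ => ((a : ℕ) : ℤ) := by
  rw [extendedCap, List.ofFn_fin_append, List.map_append, PMCode.caps, players_toCode]
  simp only [order_toCode, I.thin_toCode_iff]
  simp only [toCode, List.map_ofFn, Function.comp_def]
  congr 1
  · congr 1
    funext u
    split_ifs <;> rfl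
  · congr 1
    funext p
    exact I.partSize_toCode p

theorem extendedEdges_toCode (K : ℕ+) : I.toCode.extendedEdges ((K : ℕ) : ℤ) =
    (I.extendedGraph K).edges.map intEdge := by
  rw [extendedGraph, List.map_append, PMCode.extendedEdges, vertices_toCode, copiedEdges,
    List.map_map, pendantEdges]
  simp only [I.thin_toCode_iff, List.map_ofFn, Function.comp_def, part_toCode, order_toCode]
  congr 1
  split_ifs
  · rfl
  · simp [List.map_ofFn, Function.comp_def, intEdge]

/-- Codes of `BMInstance` do not contain the number of vertices; it is the length of the capacity
list. -/
theorem code_toBM (K : ℕ+) :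
    Coded.code (I.toCode.caps, I.toCode.extendedEdges ((K : ℕ) : ℤ)) = Coded.code (I.toBM K) := by
  rw [caps_toCode, extendedEdges_toCode]
  exact code_prod (code_map (fun a : ℕ+ => ((a : ℕ) : ℤ)) (fun _ => rfl) _) (code_map_intEdge (I.extendedGraph K).edges)

/-- A sufficiently large number, where `m` bounds the sum of the absolute values of an
allocation. -/
def margin (m : ℕ) : ℕ+ := ⟨1 + 2 * I.weightBound + m, by lia⟩

theorem margin_toCode (m : ℕ) : I.toCode.margin (m : ℤ) = ((I.margin m : ℕ) : ℤ) := by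
  have h : (I.graph.edges.map fun e => ((e.2.1 : ℕ) : ℤ)).sum = I.weightBound := by
    rw [weightBound]
    induction I.graph.edges with
    | nil => rfl
    | cons e l ih => simp [ih]
  simp only [PMCode.margin, toCode, List.map_map, margin, PNat.mk_coe]
  push_cast
  rw [← h]
  rfl

theorem weightBound_le_margin (m : ℕ) : I.weightBound ≤ (I.margin m : ℕ) := by
  simp only [margin, PNat.mk_coe]
  lia

theorem two_mul_weightBound_le_margin (m : ℕ) : 2 * I.weightBound ≤ (I.margin m : ℕ) := by
  simp only [margin, PNat.mk_coe]
  lia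

/-- The translation of rational allocations. -/
def liftFrac (K : ℕ+) (x : Fin I.k → ℤ × ℕ+) : Fin (I.n + I.k) → ℤ × ℕ+ :=
  Fin.append (fun u => if I.k = I.n then x (I.part u) else ((K : ℕ), 1))
    fun p => if I.k = I.n then (0, 1) else
      ((K : ℕ) * I.partSize p * ((x p).2 : ℕ) + (x p).1, (x p).2)

theorem fracVal_liftFrac (K : ℕ+) (x : Fin I.k → ℤ × ℕ+) :
    (fun i => fracVal (I.liftFrac K x i)) = I.liftAlloc K fun p => fracVal (x p) := by
  funext i
  induction i using Fin.addCases with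
  | left u =>
    rw [liftFrac, liftAlloc, Fin.append_left, Fin.append_left]
    split_ifs <;> simp [fracVal]
  | right p =>
    have h : (((x p).2 : ℕ) : ℝ) ≠ 0 := by exact_mod_cast (x p).2.ne_zero
    rw [liftFrac, liftAlloc, Fin.append_right, Fin.append_right]
    split_ifs
    · simp [fracVal]
    · simp only [fracVal]
      push_cast
      field_simp

theorem frac_toCode (x : Fin I.k → ℤ × ℕ+) (p : Fin I.k) :
    ((List.ofFn x).map intFrac).getInt ((p : ℕ) : ℤ) (0, 1) = intFrac (x p) := by
  rw [List.getInt_natCast, List.map_ofFn]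
  exact List.getD_ofFn _ p _

theorem liftFrac_toCode (K : ℕ+) (x : Fin I.k → ℤ × ℕ+) :
    I.toCode.liftFrac ((K : ℕ) : ℤ) ((List.ofFn x).map intFrac) =
      (List.ofFn (I.liftFrac K x)).map intFrac := by
  have h := I.frac_toCode x
  generalize (List.ofFn x).map intFrac = X at h
  rw [liftFrac, List.ofFn_fin_append, List.map_append, PMCode.liftFrac, players_toCode,
    vertices_toCode]
  simp only [order_toCode, I.thin_toCode_iff, List.map_ofFn]
  congr 2
  · funext u
    simp only [Function.comp_apply, part_toCode, h]
    split_ifs <;> rfl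
  · funext p
    simp only [Function.comp_apply, partSize_toCode, h]
    split_ifs <;> rfl

/-- The translation of coalitions back to the partitioned matching game. -/
def lowerCoalition (L : List ℕ) : List ℕ :=
  L.filterMap fun u => if h : u < I.n then some (I.part ⟨u, h⟩ : ℕ) else none

theorem lowerCoalition_toCode (L : List ℕ) :
    I.toCode.lowerCoalition (L.map fun u : ℕ => (u : ℤ)) =
      (I.lowerCoalition L).map fun u : ℕ => (u : ℤ) := by
  rw [PMCode.lowerCoalition, lowerCoalition, List.filterMap_map, List.map_filterMap]
  congr 1
  funext u
  simp only [Function.comp_apply, order_toCode]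
  by_cases h : u < I.n
  · have := I.part_toCode ⟨u, h⟩
    have h' : (u : ℤ) + 1 ≤ I.n := by lia
    simp only [h, h', if_true, dif_pos, Option.map_some]
    exact congrArg some this
  · have h' : ¬ (u : ℤ) + 1 ≤ I.n := by lia
    simp [h, h']

/-- The translation of rational allocations back to the partitioned matching game. -/
def lowerFrac (K : ℕ+) (t : List (ℤ × ℕ+)) (p : Fin I.k) : ℤ × ℕ+ :=
  fracSum ((List.ofFn fun u => if I.part u = p then t.getD u (0, 1) else (0, 1)) ++
    [t.getD (I.n + p) (0, 1), (if I.k = I.n then 0 else 0 - 2 * (K : ℕ) * I.partSize p, 1)])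

/-- Vertices of other players enter as the fraction `(0, 1)` of value zero, so summing over all
vertices is the same as summing over the part. -/
theorem fracVal_lowerFrac (K : ℕ+) (y : Fin (I.n + I.k) → ℤ × ℕ+) (p : Fin I.k) :
    fracVal (I.lowerFrac K (List.ofFn y) p) = I.lowerAlloc K (fun i => fracVal (y i)) p := by
  have h₁ : ∀ u : Fin I.n, (List.ofFn y).getD u (0, 1) = y (I.vertexEmb u) := fun u =>
    List.getD_ofFn y (u.castAdd I.k) _
  have h₂ : (List.ofFn y).getD (I.n + p) (0, 1) = y (I.playerEmb p) :=
    List.getD_ofFn y (p.natAdd I.n) _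
  have h₃ : fracVal (0, 1) = 0 := by simp [fracVal]
  rw [lowerFrac, fracVal_fracSum, h₂]
  simp only [h₁, List.map_append, List.map_ofFn, List.sum_append, List.sum_ofFn,
    Function.comp_apply, apply_ite fracVal, h₃, List.map_cons, List.map_nil, List.sum_cons,
    List.sum_nil, lowerAlloc, Finset.sum_filter]
  split_ifs
  · rw [h₃]
    ring
  · simp only [fracVal]
    push_cast
    ring

theorem lowerFrac_toCode (K : ℕ+) (t : List (ℤ × ℕ+)) :
    I.toCode.lowerFrac ((K : ℕ) : ℤ) (t.map intFrac) =
      (List.ofFn (I.lowerFrac K t)).map intFrac := by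
  have ht : ∀ i : ℕ, (t.map intFrac).getInt (i : ℤ) (0, 1) = intFrac (t.getD i (0, 1)) :=
    fun i => by
      rw [← List.getInt_natCast]
      exact List.getInt_map intFrac t i (0, 1)
  rw [PMCode.lowerFrac, players_toCode, vertices_toCode, List.map_ofFn, List.map_ofFn]
  congr 1
  funext p
  simp only [Function.comp_apply, lowerFrac, ← intFracSum_map, List.map_append, List.map_ofFn,
    I.thin_toCode_iff, order_toCode, partSize_toCode, List.map_cons, List.map_nil, ← Nat.cast_add,
    ht]
  congr 2
  · congr 1
    funext u
    simp only [Function.comp_apply, part_toCode, Nat.cast_inj, Fin.val_inj, ht]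
    split_ifs <;> rfl

end PMInstance

end Encodings

/-! ### The reductions -/

/-- Only membership in `L` matters, and every finite set of players can be listed. -/
theorem exists_isViolated_iff {m : ℕ} (Γ : CoopGame (Fin m)) (x : Fin m → ℝ) :
    (∃ L, IsViolated Γ x L) ↔ ∃ S : Finset (Fin m), ∑ p ∈ S, x p < Γ.v S := by
  refine ⟨fun ⟨L, hL⟩ => ⟨_, hL.2⟩, fun ⟨S, hS⟩ => ⟨S.toList.map Fin.val, ?_, ?_⟩⟩
  · intro a ha
    obtain ⟨p, -, rfl⟩ := List.mem_map.1 ha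
    exact p.2
  · have : (Finset.univ.filter fun p : Fin m => (p : ℕ) ∈ S.toList.map Fin.val) = S := by
      ext p
      simp [Fin.val_inj]
    rwa [this]

namespace PMAllocInstance

variable (J : PMAllocInstance)

/-- The number that is used in the translation of `J`. -/
def margin : ℕ+ := J.inst.margin ((List.ofFn J.x).map fun q => q.1.natAbs).sum

/-- The absolute values of the numerators dominate those of the fractions; their sum is the second
ingredient of `margin`. -/
theorem totalWeight_add_le : IsPendantExtension.totalWeight J.inst.graph.graph J.inst.graph.weight +
    ∑ p, |fracVal (J.x p)| ≤ (J.margin : ℕ) := by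
  have h₁ := J.inst.totalWeight_le
  have h₂ : ∑ p, |fracVal (J.x p)| ≤ ∑ p, ((J.x p).1.natAbs : ℝ) :=
    Finset.sum_le_sum fun p _ => abs_fracVal_le _
  simp only [margin, PMInstance.margin, PNat.mk_coe, List.map_ofFn, List.sum_ofFn,
    Function.comp_apply]
  push_cast
  have h₃ : (0 : ℝ) ≤ J.inst.weightBound := Nat.cast_nonneg _
  linarith

/-- The translation of partitioned matching games with an allocation. -/
def toBMAlloc : BMAllocInstance where
  inst := J.inst.toBM J.margin
  x := J.inst.liftFrac J.margin J.x
  isAllocation := by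
    refine Eq.mpr (congrArg (J.inst.extendedGame J.margin).IsAllocation
      (J.inst.fracVal_liftFrac J.margin J.x)) ?_
    exact (J.inst.isAllocation_liftAlloc_iff (J.inst.weightBound_le_margin _) _).2 J.isAllocation

/-- The encoding of the instance. -/
def toCode : PMCode × List (ℤ × ℤ) := (J.inst.toCode, (List.ofFn J.x).map intFrac)

theorem code_toCode : Coded.code J.toCode = Coded.code J :=
  code_prod J.inst.code_toCode (code_map_intFrac _)

theorem margin_toCode :
    J.toCode.1.margin (J.toCode.2.map fun q => |q.1|).sum = ((J.margin : ℕ) : ℤ) := by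
  rw [margin, ← PMInstance.margin_toCode, toCode]
  congr 1
  simp only [List.map_ofFn, List.sum_ofFn, Function.comp_apply, intFrac]
  push_cast
  rfl

theorem polyTime_toBMAlloc : PolyTime toBMAlloc := by
  have hK : PolyTime fun c : PMCode × List (ℤ × ℤ) =>
      c.1.margin (c.2.map fun q => |q.1|).sum :=
    PolyTime.margin PolyTime.id.fst (PolyTime.map PolyTime.id.snd PolyTime.id.snd.fst.abs).sum
  refine PolyTime.of_code (PolyTime.pair (PolyTime.pair (PolyTime.caps PolyTime.id.fst)
    (PolyTime.extendedEdges PolyTime.id.fst hK))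
    (PolyTime.liftFrac PolyTime.id.fst hK PolyTime.id.snd)) toCode code_toCode fun J => ?_
  rw [margin_toCode]
  refine code_prod (J.inst.code_toBM J.margin) ?_
  rw [toCode, PMInstance.liftFrac_toCode]
  exact code_map_intFrac _

end PMAllocInstance

theorem PMAllocInstance.polyTime_lowerCoalition :
    PolyTime fun s : PMAllocInstance × List ℕ => s.1.inst.lowerCoalition s.2 :=
  PolyTime.of_code (PolyTime.lowerCoalition
      (c := fun s : (PMCode × List (ℤ × ℤ)) × List ℤ => s.1.1) PolyTime.id.fst.fst PolyTime.id.snd)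
    (fun s => (s.1.toCode, s.2.map fun u : ℕ => (u : ℤ)))
    (fun s => code_prod s.1.code_toCode (code_map_natCast _)) fun s => by
      simp only [toCode, PMInstance.lowerCoalition_toCode]
      exact code_map_natCast _

theorem PMInstance.polyTime_toBM : PolyTime fun I : PMInstance => I.toBM (I.margin 0) :=
  PolyTime.of_code (PolyTime.pair (PolyTime.caps .id)
      (PolyTime.extendedEdges .id (PolyTime.margin .id (PolyTime.const 0))))
    toCode code_toCode fun I => by
      rw [← I.code_toBM, ← margin_toCode]
      rfl

theorem PMInstance.polyTime_lowerFrac : PolyTime fun s : PMInstance × List (ℤ × ℕ+) =>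
    List.ofFn (s.1.lowerFrac (s.1.margin 0) s.2) :=
  PolyTime.of_code (PolyTime.lowerFrac PolyTime.id.fst
      (PolyTime.margin PolyTime.id.fst (PolyTime.const 0)) PolyTime.id.snd)
    (fun s : PMInstance × List (ℤ × ℕ+) => (s.1.toCode, s.2.map intFrac))
    (fun s => code_prod s.1.code_toCode (code_map_intFrac _)) fun s => by
      have h := s.1.margin_toCode 0
      rw [Nat.cast_zero] at h
      simp only [h, lowerFrac_toCode]
      exact code_map_intFrac _

theorem BM.P1_toBMAlloc_iff (J : PMAllocInstance) (L : List ℕ) :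
    BM.P1 J.toBMAlloc L ↔ IsViolated (J.inst.extendedGame J.margin)
      (J.inst.liftAlloc J.margin fun p => fracVal (J.x p)) L := by
  rw [← J.inst.fracVal_liftFrac]
  rfl

/-- The list describes the owners of the vertices in the given coalition; entries from `n` on stand
for players and are dropped. -/
theorem PM.P1_lowerCoalition (J : PMAllocInstance) {L : List ℕ} (hL : BM.P1 J.toBMAlloc L) :
    PM.P1 J (J.inst.lowerCoalition L) := by
  have h' := J.inst.violated_of_violated J.totalWeight_add_le ((BM.P1_toBMAlloc_iff J L).1 hL).2
  refine ⟨fun a ha => ?_, ?_⟩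
  · obtain ⟨u, -, hu⟩ := List.mem_filterMap.1 ha
    split_ifs at hu
    obtain rfl := Option.some.inj hu
    exact Fin.is_lt _
  · convert h' using 2 <;>
    · ext p
      simp only [Finset.mem_filter, Finset.mem_univ, true_and, PMInstance.lowerCoalition,
        List.mem_filterMap, Finset.mem_image, IsPendantExtension.mem_vertices]
      constructor
      · rintro ⟨u, hu, hp⟩
        split_ifs at hp with hn
        exact ⟨⟨u, hn⟩, by simpa using hu, Fin.ext (Option.some.inj hp)⟩
      · rintro ⟨u, hu, rfl⟩
        exact ⟨u, by simpa using hu, by simp⟩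

/-- A violated coalition `T` yields a violated full coalition because the excess is unchanged. -/
theorem searchReduces_P1 :
    SearchReduces PM.P1 (fun J => J.inst.width) BM.P1 (fun J => J.inst.bstar) := by
  refine ⟨_, _, PMAllocInstance.polyTime_toBMAlloc, PMAllocInstance.polyTime_lowerCoalition,
    fun J => ⟨J.inst.bstar_toBM_le _, ⟨fun h => ?_, fun ⟨L, hL⟩ => ⟨_, PM.P1_lowerCoalition J hL⟩⟩,
      fun L hL => PM.P1_lowerCoalition J hL⟩⟩
  obtain ⟨T, hT⟩ := (exists_isViolated_iff _ _).1 h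
  simp only [BM.P1_toBMAlloc_iff]
  refine (exists_isViolated_iff _ _).2
    ⟨IsPendantExtension.fullCoalition J.inst.part J.inst.vertexEmb J.inst.playerEmb T, ?_⟩
  have := J.inst.excess_fullCoalition (K := J.margin) (J.inst.weightBound_le_margin _)
    (fun p => fracVal (J.x p)) T
  exact sub_neg.1 (this.trans_lt (sub_neg.2 hT))

/-- Non-emptiness passes in both directions through real allocations. The margin with `m = 0`
suffices, since it already exceeds twice the weight bound. -/
theorem decisionReduces_P2 :
    DecisionReduces PM.P2 PMInstance.width BM.P2 BMInstance.bstar :=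
  ⟨_, PMInstance.polyTime_toBM, fun I => ⟨I.bstar_toBM_le _,
    fun ⟨_, hx⟩ => ⟨_, I.liftAlloc_mem_core (I.two_mul_weightBound_le_margin 0) hx⟩,
    fun ⟨_, hy⟩ => ⟨_, I.lowerAlloc_mem_core (I.weightBound_le_margin 0) hy⟩⟩⟩

theorem PM.P3_lowerFrac (I : PMInstance) {L : List (ℤ × ℕ+)}
    (hL : BM.P3 (I.toBM (I.margin 0)) L) :
    PM.P3 I (List.ofFn (I.lowerFrac (I.margin 0) L)) := by
  obtain ⟨y, rfl, hy⟩ := hL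
  refine ⟨_, rfl, ?_⟩
  have h : (fun p => fracVal (I.lowerFrac (I.margin 0) (List.ofFn y) p)) =
      I.lowerAlloc (I.margin 0) fun i => fracVal (y i) :=
    funext fun p => I.fracVal_lowerFrac _ y p
  rw [h]
  exact I.lowerAlloc_mem_core (I.weightBound_le_margin 0) hy

/-- Both translations of allocations preserve rationality, so they also relate the rational points
of the two cores. -/
theorem searchReduces_P3 :
    SearchReduces PM.P3 PMInstance.width BM.P3 BMInstance.bstar := by
  refine ⟨_, _, PMInstance.polyTime_toBM, PMInstance.polyTime_lowerFrac,
    fun I => ⟨I.bstar_toBM_le _, ⟨?_, fun ⟨L, hL⟩ => ⟨_, PM.P3_lowerFrac I hL⟩⟩,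
      fun L hL => PM.P3_lowerFrac I hL⟩⟩
  rintro ⟨-, x, rfl, hx⟩
  refine ⟨_, I.liftFrac (I.margin 0) x, rfl, ?_⟩
  have := I.liftAlloc_mem_core (I.two_mul_weightBound_le_margin 0) hx
  rw [← I.fracVal_liftFrac] at this
  exact this

end

theorem theorem3 :
    SearchReduces PM.P1 (fun J => J.inst.width) BM.P1 (fun J => J.inst.bstar) ∧
    DecisionReduces PM.P2 PMInstance.width BM.P2 BMInstance.bstar ∧
    SearchReduces PM.P3 PMInstance.width BM.P3 BMInstance.bstar :=
  ⟨searchReduces_P1, decisionReduces_P2, searchReduces_P3⟩
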